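/- **Setting.** Let $(\mathbb X,\rho)$ be a connected metric space whose closed balls $\mathbb B(x,r)=\{y:\rho(x,y)\le r\}$ are compact, $\mu^*$ a positive $\sigma$-finite Borel measure on $\mathbb X$, $0=\lambda_0\le\lambda_1\le\cdots\uparrow\infty$, and $\{\phi_k\}_{k\ge 0}\subset L^1(\mu^*)\cap C_0(\mathbb X)$ a system of real functions, orthonormal with respect to $\mu^*$, with $\phi_0>0$ everywhere and with span dense in $C_0(\mathbb X)$. Put $\Pi_n=\mathrm{span}\{\phi_k:\lambda_k<n\}$ ($n>0$ real). Assume that this is a *data space*: 1. there are $q\ge 1$, $\kappa>0$ with $\mu^*(\mathbb B(x,r))=\mu^*(\{y:\rho(x,y)<r\})\le\kappa r^q$ for all $x\in\mathbb X$, $r>0$; 2. there are $\kappa_1,\kappa_2>0$ such that for all $x,y\in\mathbb X$ and $0<t\le 1$ the series $\sum_k e^{-\lambda_k^2t}\phi_k(x)\phi_k(y)$ converges and is at most $\kappa_1t^{-q/2}\exp(-\kappa_2\rho(x,y)^2/t)$ in absolute value; 3. for every real $n\ge 1$ there is a compact set $\mathbb K_n\subset\mathbb X$, with $\mathbb K_n\subseteq\mathbb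 K_m$ for $n<m$ and $\mu^*(\mathbb K_1)>0$, such that $n\mapsto\mathrm{diam}(\mathbb K_n)$ has polynomial growth ($\le c\,n^{c'}$ for $n\ge1$) and both $\sup_{x\notin\mathbb K_n}\sum_{\lambda_k<n}\phi_k(x)^2$ and $\int_{\mathbb X\setminus\mathbb K_n}\bigl(\sum_{\lambda_k<n}\phi_k^2\bigr)^{1/2}d\mu^*$ are $o(n^{-S})$ as $n\to\infty$ for every $S>0$. For $K\subset\mathbb X$ and $r\ge 0$ let $\mathbb B(K,r)=\{x:\inf_{y\in K}\rho(x,y)\le r\}$, and for nonempty $\mathcal C\subset K$ let $\delta(K,\mathcal C)=\sup_{x\in K}\inf_{y\in\mathcal C}\rho(x,y)$. The Bernstein–Lipschitz condition with constants $B_n>0$ ($n>0$) says that $$|P(x)-P(y)|\le B_n\,\rho(x,y)\,\|P\|_\infty,\qquad x,y\in\mathbb X,\ P\in\Pi_n,\ n>0 .$$ **Theorem.** Given such a data space (with its sets $\mathbb K_n$), there are constants $c_1,c_2>0$ and, for each $\epsilon>0$, constants $c(\epsilon)>0$, $A_\epsilon>0$, $N_\epsilon>0$ with the following properties. Let the Bernstein–Lipschitz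 condition hold with constants $B_n$, let $n>0$, and put $\epsilon_n=\min(1/n,1/B_{2n})$. Let $\mathcal C_1=\{z_1,\dots,z_M\}\subset\mathbb K_{2n}$, $M\ge 1$, and write $\delta_1=\delta(\mathbb K_{2n},\mathcal C_1)$. (a) Let $\epsilon>0$, and let $n\ge N_\epsilon$, or else let $\mathbb X$ be compact and $\mathbb K_{2n}=\mathbb X$. If $\delta_1\le c(\epsilon)\epsilon_n$, then there are numbers $W_k\ge 0$ with $$W_k\le c_1\delta_1^{\,q},\qquad \sum_{k=1}^MW_k\le c_1\,\mu^*\bigl(\mathbb B(\mathbb K_{2n},4\delta_1)\bigr),$$ $$\left|\sum_{k=1}^MW_k|P(z_k)|-\int_{\mathbb X}|P|\,d\mu^*\right|\le\epsilon\int_{\mathbb X}|P|\,d\mu^*,\qquad P\in\Pi_n .$$ (b) Let the assumptions of (a) hold with $\epsilon=1/2$. For all $W_k\ge0$ as in (a) with $\epsilon=1/2$ there are real numbers $w_1,\dots,w_M$ with $|w_k|\le 2W_k$ for all $k$, $$\sum_{k=1}^M|w_k|\le c_2\,\mu^*\bigl(\mathbb B(\mathbb K_{2n},4\delta_1)\bigr),\qquad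 \sum_{k=1}^Mw_kP(z_k)=\int_{\mathbb X}P\,d\mu^*,\quad P\in\Pi_n .$$ (c) Let $\epsilon>0$ and $\delta>0$, and let $n\ge N_\epsilon$, or else let $\mathbb X$ be compact, $\mathbb K_{2n}=\mathbb X$ and $\mu^*(\mathbb B(\mathbb K_{2n},\epsilon_n))\ge 2\delta\epsilon_n^q$. If $$M\ge A_\epsilon\,\epsilon_n^{-q}\,\mu^*(\mathbb K_{2n})\log\left(\frac{\mu^*(\mathbb B(\mathbb K_{2n},\epsilon_n))}{\delta\,\epsilon_n^q}\right)$$ and $z_1,\dots,z_M$ are drawn independently from the law $B\mapsto\mu^*(B\cap\mathbb K_{2n})/\mu^*(\mathbb K_{2n})$, then with probability exceeding $1-\delta$ both conclusions hold for $\mathcal C_1=\{z_1,\dots,z_M\}$: there are weights $W_k$ as in (a) for $\epsilon$, and there are weights $W_k$ as in (a) for $1/2$ together with $w_k$ as in (b). -/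

import Mathlib

open Set Filter Topology MeasureTheory
open scoped ZeroAtInfty ENNReal

noncomputable section

/-- A real function of `n ≥ 1` has polynomial growth. -/
def PolynomialGrowth (F : ℝ → ℝ) : Prop :=
  ∃ c₁ > 0, ∃ c₂ > 0, ∀ n : ℝ, 1 ≤ n → |F n| ≤ c₁ * n ^ c₂

/-- A real function is fast decreasing: `n ^ S * F n → 0` as `n → ∞`, for every `S > 0`. -/
def FastDecreasing (F : ℝ → ℝ) : Prop :=
  ∀ S : ℝ, 0 < S → Tendsto (fun n : ℝ => n ^ S * F n) atTop (𝓝 0)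

/-- `∑_{λ_k < n} φ_k(x)²` (a finite sum when `λ_k → ∞`). -/
def christoffelSum {X : Type*} (lam : ℕ → ℝ) (phi : ℕ → X → ℝ) (n : ℝ) (x : X) : ℝ :=
  ∑ᶠ (k : ℕ) (_ : lam k < n), phi k x ^ 2

/-- A data space `(X, ρ, μ, {λ_k}, {φ_k})` together with its ball-measure constants `q, κ`, its
Gaussian constants `κ₁, κ₂` and its compact sets `K_n`, `n ≥ 1`. The metric is that of `X`; that
closed balls are compact is the type class `ProperSpace X`. The functions `φ_k` are continuous
and vanish at infinity (on a proper space such functions are uniformly continuous). -/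
structure DataSpace (X : Type*) [MetricSpace X] [ConnectedSpace X] [ProperSpace X]
    [MeasurableSpace X] [BorelSpace X] where
  /-- the measure on `X` -/
  μ : Measure X
  sigmaFinite : SigmaFinite μ
  /-- the numbers `λ_k` -/
  lam : ℕ → ℝ
  lam_zero : lam 0 = 0
  lam_mono : Monotone lam
  lam_tendsto : Tendsto lam atTop atTop
  /-- the orthonormal system `φ_k` -/
  phi : ℕ → C₀(X, ℝ)
  phi_integrable : ∀ k, Integrable (fun x => phi k x) μ
  phi_orthonormal : ∀ j k, ∫ x, phi j x * phi k x ∂μ = if j = k then 1 else 0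
  phi_zero_pos : ∀ x, 0 < phi 0 x
  /-- the linear combinations of the `φ_k` are uniformly dense in `C₀` -/
  dense_span : Dense (Submodule.span ℝ (range phi) : Set C₀(X, ℝ))
  /-- the exponent in the ball measure condition -/
  q : ℝ
  one_le_q : 1 ≤ q
  κ : ℝ
  κ_pos : 0 < κ
  ball_measure : ∀ (x : X) (r : ℝ), 0 < r →
    μ (Metric.closedBall x r) = μ (Metric.ball x r) ∧
      μ (Metric.ball x r) ≤ ENNReal.ofReal (κ * r ^ q)
  κ₁ : ℝ
  κ₁_pos : 0 < κ₁
  κ₂ : ℝ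
  κ₂_pos : 0 < κ₂
  /-- Gaussian upper bound; the series converges -/
  gaussian_bound : ∀ (x y : X) (t : ℝ), 0 < t → t ≤ 1 →
    Summable (fun k => Real.exp (-(lam k ^ 2) * t) * phi k x * phi k y) ∧
      |∑' k, Real.exp (-(lam k ^ 2) * t) * phi k x * phi k y| ≤
        κ₁ * t ^ (-(q / 2)) * Real.exp (-(κ₂ * (dist x y ^ 2 / t)))
  /-- the compact sets `K_n` (only the values at `n ≥ 1` are constrained) -/
  K : ℝ → Set X
  K_compact : ∀ n : ℝ, 1 ≤ n → IsCompact (K n)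
  K_mono : ∀ n m : ℝ, 1 ≤ n → n < m → K n ⊆ K m
  K_one_pos : 0 < μ (K 1)
  K_diam : PolynomialGrowth fun n => Metric.diam (K n)
  K_sup : FastDecreasing fun n =>
    ⨆ x : ↥(K n)ᶜ, christoffelSum lam (fun k x => phi k x) n (x : X)
  K_integral : FastDecreasing fun n =>
    ∫ x in (K n)ᶜ, (christoffelSum lam (fun k x => phi k x) n x) ^ (1 / 2 : ℝ) ∂μ

/-- The mesh norm `δ(K, C) = sup_{x ∈ K} inf_{y ∈ C} ρ(x, y)` (for bounded `K` and nonempty `C`). -/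
def meshNorm {X : Type*} [MetricSpace X] (K C : Set X) : ℝ :=
  ⨆ x : ↥K, Metric.infDist (x : X) C

namespace DataSpace

variable {X : Type*} [MetricSpace X] [ConnectedSpace X] [ProperSpace X]
  [MeasurableSpace X] [BorelSpace X]

/-- Diffusion polynomials of order less than `n`: `Π_n = span {φ_k : λ_k < n}`. -/
def poly (Ξ : DataSpace X) (n : ℝ) : Submodule ℝ C₀(X, ℝ) :=
  Submodule.span ℝ (Ξ.phi '' {k | Ξ.lam k < n})

/-- The Bernstein–Lipschitz condition with constants `B_n`; `‖P‖` is the supremum norm. -/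
def BernsteinLipschitz (Ξ : DataSpace X) (B : ℝ → ℝ) : Prop :=
  ∀ n : ℝ, 0 < n → 0 < B n ∧
    ∀ P ∈ Ξ.poly n, ∀ x y : X, |P x - P y| ≤ B n * dist x y * ‖P‖

/-- The mesh norm of the points `z_1, …, z_M` in `K_{2n}`. -/
def mesh (Ξ : DataSpace X) (n : ℝ) {M : ℕ} (z : Fin M → X) : ℝ :=
  meshNorm (Ξ.K (2 * n)) (range z)

/-- `μ(𝔹(K_{2n}, r))` where `𝔹(K, r)` is the set of points at distance at most `r` from `K`. -/
def nbhdMeasure (Ξ : DataSpace X) (n r : ℝ) : ℝ :=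
  Ξ.μ.real (Metric.cthickening r (Ξ.K (2 * n)))

/-- The weights `W_k ≥ 0` at the points `z_k` satisfy the size bounds with constant `c`, and the
Marcinkiewicz–Zygmund inequality for `Π_n` with relative error `ε`. -/
def IsMZ (Ξ : DataSpace X) (n c ε : ℝ) {M : ℕ} (z : Fin M → X) (W : Fin M → ℝ) : Prop :=
  (∀ k, 0 ≤ W k) ∧
  (∀ k, W k ≤ c * Ξ.mesh n z ^ Ξ.q) ∧
  ∑ k, W k ≤ c * Ξ.nbhdMeasure n (4 * Ξ.mesh n z) ∧
  ∀ P ∈ Ξ.poly n, |∑ k, W k * |P (z k)| - ∫ x, |P x| ∂Ξ.μ| ≤ ε * ∫ x, |P x| ∂Ξ.μ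

/-- The real weights `w_k` at the points `z_k` are dominated by `2 W_k`, their absolute sum is
bounded with constant `c`, and they give a quadrature formula exact on `Π_n`. -/
def IsQuadrature (Ξ : DataSpace X) (n c : ℝ) {M : ℕ} (z : Fin M → X) (W w : Fin M → ℝ) : Prop :=
  (∀ k, |w k| ≤ 2 * W k) ∧
  ∑ k, |w k| ≤ c * Ξ.nbhdMeasure n (4 * Ξ.mesh n z) ∧
  ∀ P ∈ Ξ.poly n, ∑ k, w k * P (z k) = ∫ x, P x ∂Ξ.μ

/-- The law of `M` independent points drawn from the normalized restriction of `μ` to `K_{2n}`. -/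
def sampleLaw (Ξ : DataSpace X) (n : ℝ) (M : ℕ) : Measure (Fin M → X) :=
  Measure.pi fun _ => ProbabilityTheory.cond Ξ.μ (Ξ.K (2 * n))

end DataSpace

end

/-! The Marcinkiewicz–Zygmund weights are measures of nearest-point cells. If every point of a cell
is within `s` of its node, then replacing `∫ |P|` over the cells by `∑ W k * |P (z k)|` costs at
most the integral of the oscillation of `P` at scale `s`. What is left is the mass of `P` off the
cells. So for `P` in `Π_n` one needs small `L¹` oscillation on `K_{2n}` at scale `a ε_n`
(`exists_oscillation_le`) and negligible mass outside `K_{2n}` (`exists_lintegral_compl_K_le`).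

The tail bound is Cauchy–Schwarz for the reproducing kernel `∑ φ_k(x) φ_k(y)`, whose diagonal grows
polynomially while its square root has a rapidly decreasing integral off `K_{2n}`. The oscillation
bound writes `P` as the integral of `P` against a smoothly cut off kernel of order `2n`. Near the
diagonal this kernel varies little by the Bernstein–Lipschitz condition for `Π_{2n}`; away from it
the kernel is itself small in `L¹`. Localization (`abs_kernel_le`) follows from the Gaussian bound
alone: in the variable `s = exp (-u²)` the cutoff is approximated by truncated Chebyshev series,
that is, by sums of `J` Gaussians. Their coefficients are at most exponential in `J`, and for `J` a
small multiple of `m ρ` the off-diagonal decay of the heat kernel beats them.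

For random points no lower bound on ball measures is available, so the mesh norm of a sample need
not be small. This does not matter: the points of `K_{2n}` whose balls have small measure carry
little mass of `P` (`exists_lintegral_thin_le`), because the reproducing formula sees too little
measure near such points. The remaining points have a finite net of controlled cardinality, and a
union bound shows that a sample comes close to all of them (`measure_pi_cond_uncovered_le`).

Exact quadrature is duality: relative error `1/2` gives `|∫ P| ≤ 2 ∑ W k * |P (z k)|`, and
Hahn–Banach represents the integral by weights dominated by `2 W k`. -/

section FourierDecay

/-! ### Decay of Fourier coefficients of smooth periodic functions -/

theorem norm_fourierCoeffOn_le {T : ℝ} (hT : 0 < T) {f : ℝ → ℂ} {C : ℝ}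
    (hC : ∀ x, ‖f x‖ ≤ C) (n : ℤ) :
    ‖fourierCoeffOn (lt_add_of_pos_right (0 : ℝ) hT) f n‖ ≤ C := by
  have : Fact (0 < (0 + T - 0)) := ⟨by linarith⟩
  rw [fourierCoeffOn_eq_integral, norm_smul]
  have h1 : ‖∫ x in (0 : ℝ)..0 + T, fourier (-n) (x : AddCircle (0 + T - 0)) • f x‖
      ≤ C * |0 + T - 0| := by
    apply intervalIntegral.norm_integral_le_of_norm_le_const
    intro x _
    rw [norm_smul]
    have : ‖(fourier (-n) (x : AddCircle (0 + T - 0)) : ℂ)‖ = 1 := by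
      rw [fourier_apply, Circle.norm_coe]
    rw [this, one_mul]
    exact hC x
  have h2 : |0 + T - 0| = T := by rw [abs_of_pos] <;> simp [hT]
  rw [h2] at h1
  have h3 : ‖(1 / (0 + T - 0) : ℝ)‖ = 1 / T := by
    rw [Real.norm_eq_abs, abs_of_pos] <;> simp [hT]
  rw [h3]
  calc 1 / T * _ ≤ 1 / T * (C * T) := by gcongr
    _ = C := by field_simp

/-- Each integration by parts gains a factor `1 / |n|`; the boundary terms cancel by periodicity,
and the derivative is again smooth and periodic. -/
theorem fourierCoeffOn_decay {T : ℝ} (hT : 0 < T) (S : ℕ) : ∀ f : ℝ → ℂ, ContDiff ℝ (⊤ : ℕ∞) f →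
    Function.Periodic f T → ∃ C : ℝ, 0 < C ∧ ∀ n : ℤ, n ≠ 0 →
      ‖fourierCoeffOn (lt_add_of_pos_right (0 : ℝ) hT) f n‖ ≤ C / |(n : ℝ)| ^ S := by
  induction S with
  | zero =>
    intro f hf hp
    obtain ⟨C, hC⟩ : ∃ C, ∀ x, ‖f x‖ ≤ C := by
      have := (isCompact_Icc (a := (0 : ℝ)) (b := 0 + T)).exists_bound_of_continuousOn
        hf.continuous.continuousOn
      obtain ⟨C, hC⟩ := this
      refine ⟨C, fun x => ?_⟩
      obtain ⟨y, hy, hxy⟩ := hp.exists_mem_Ico hT x 0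
      rw [hxy]
      exact hC y ⟨hy.1, hy.2.le⟩
    refine ⟨max C 1, by positivity, fun n _ => ?_⟩
    simpa using Or.inl (norm_fourierCoeffOn_le hT hC n)
  | succ S ih =>
    intro f hf hp
    have hf' : ContDiff ℝ (⊤ : ℕ∞) (deriv f) := by
      exact (contDiff_infty_iff_deriv.1 hf).2
    have hd : Differentiable ℝ f := (contDiff_infty_iff_deriv.1 hf).1
    have hp' : Function.Periodic (deriv f) T := fun x => by
      have : f = fun y => f (y + T) := by ext y; rw [hp]
      conv_rhs => rw [this]
      rw [deriv_comp_add_const]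
    obtain ⟨C, hC0, hC⟩ := ih _ hf' hp'
    refine ⟨T * C, by positivity, fun n hn => ?_⟩
    rw [fourierCoeffOn_of_hasDerivAt _ hn (fun x _ => (hd x).hasDerivAt)
      (hf'.continuous.intervalIntegrable _ _)]
    have h0 : f (0 + T) - f 0 = 0 := by rw [hp]; simp
    have hn' : 0 < |(n : ℝ)| := by positivity
    rw [h0, mul_zero, zero_sub, norm_mul, norm_neg, norm_mul]
    have e1 : ‖(1 / (-2 * Real.pi * Complex.I * n) : ℂ)‖ = 1 / (2 * Real.pi * |(n : ℝ)|) := by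
      simp [abs_of_pos Real.pi_pos]
    have e2 : ‖((0 + T : ℝ) : ℂ) - (0 : ℝ)‖ = T := by simp [abs_of_pos hT]
    rw [e1, e2]
    have hpi : 1 ≤ 2 * Real.pi := by linarith [Real.pi_gt_three]
    calc 1 / (2 * Real.pi * |(n : ℝ)|) * (T * _)
        ≤ 1 / (1 * |(n : ℝ)|) * (T * (C / |(n : ℝ)| ^ S)) := by
          gcongr
          exact hC n hn
      _ = T * C / |(n : ℝ)| ^ (S + 1) := by
          rw [pow_succ]; field_simp

/-- A smooth even `2π`-periodic function is the sum of a cosine series whose coefficients decay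
faster than every power. -/
theorem exists_cosine_series {G : ℝ → ℝ} (hG : ContDiff ℝ (⊤ : ℕ∞) G)
    (hper : Function.Periodic G (2 * Real.pi)) (heven : ∀ x, G (-x) = G x) :
    ∃ c : ℤ → ℝ, (∀ S : ℕ, ∃ C : ℝ, 0 < C ∧ ∀ k, |c k| ≤ C / (|(k : ℝ)| + 1) ^ S) ∧
      ∀ x, HasSum (fun k => c k * Real.cos (k * x)) (G x) := by
  have hT : 0 < 2 * Real.pi := by positivity
  have : Fact (0 < 2 * Real.pi) := ⟨hT⟩
  set f : ℝ → ℂ := fun x => (G x : ℂ) with hf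
  have hfs : ContDiff ℝ (⊤ : ℕ∞) f := Complex.ofRealCLM.contDiff.comp hG
  have hfp : Function.Periodic f (2 * Real.pi) := fun x => by simp [hf, hper x]
  set b : ℤ → ℂ := fun n => fourierCoeffOn (lt_add_of_pos_right (0 : ℝ) hT) f n with hb
  have hdecay : ∀ S : ℕ, ∃ C : ℝ, 0 < C ∧ ∀ k, ‖b k‖ ≤ C / (|(k : ℝ)| + 1) ^ S := by
    intro S
    obtain ⟨C, hC0, hC⟩ := fourierCoeffOn_decay hT S f hfs hfp
    -- The decay estimate excludes `k = 0`, hence the first term; for `k ≠ 0` one has `|k| + 1 ≤ 2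
    -- |k|`, hence the factor `2 ^ S`.
    refine ⟨max (‖b 0‖) (C * 2 ^ S), by positivity, fun k => ?_⟩
    rcases eq_or_ne k 0 with rfl | hk
    · simp
    · refine (hC k hk).trans ?_
      have h1 : 1 ≤ |(k : ℝ)| := by
        have := Int.one_le_abs hk
        exact_mod_cast this
      rw [div_le_div_iff₀ (by positivity) (by positivity)]
      calc C * (|(k : ℝ)| + 1) ^ S ≤ C * (2 * |(k : ℝ)|) ^ S := by gcongr; linarith
        _ = C * 2 ^ S * |(k : ℝ)| ^ S := by rw [mul_pow]; ring
        _ ≤ _ := by gcongr; exact le_max_right _ _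
  have hlc : Continuous (AddCircle.liftIco (2 * Real.pi) 0 f) :=
    AddCircle.liftIco_continuous (by simpa using (hfp 0).symm) hfs.continuous.continuousOn
  set F : C(AddCircle (2 * Real.pi), ℂ) := ⟨_, hlc⟩ with hF
  have hFb : fourierCoeff F = b := by
    ext n
    exact fourierCoeff_liftIco_eq f n
  have hsum2 : Summable fun k : ℤ => (1 : ℝ) / (|(k : ℝ)| + 1) ^ 2 := by
    have h2 : Summable fun k : ℤ => 1 / |(k : ℝ)| ^ 2 := by
      simpa using Real.summable_one_div_int_pow.2 (le_refl 2)
    refine h2.of_norm_bounded_eventually ?_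
    have : ∀ᶠ k : ℤ in cofinite, k ≠ 0 := (finite_singleton (0 : ℤ)).compl_mem_cofinite
    filter_upwards [this] with k hk
    have h1 : 0 < |(k : ℝ)| := by positivity
    rw [Real.norm_of_nonneg (by positivity)]
    gcongr
    linarith
  have hsum : Summable b := by
    obtain ⟨C, _, hC⟩ := hdecay 2
    refine (hsum2.mul_left C).of_norm_bounded fun k => (hC k).trans (by rw [mul_one_div])
  have key : ∀ x : ℝ, HasSum (fun k : ℤ => b k * Complex.exp (k * x * Complex.I)) (f x) := by
    intro x
    have h := has_pointwise_sum_fourier_series_of_summable (f := F) (by rw [hFb]; exact hsum)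
      (x : AddCircle (2 * Real.pi))
    have hx : F (x : AddCircle (2 * Real.pi)) = f x := by
      obtain ⟨y', hy', m, hm⟩ : ∃ y ∈ Ico (0 : ℝ) (0 + 2 * Real.pi), ∃ m : ℤ,
          x = y + m • (2 * Real.pi) := by
        obtain ⟨m, hm, -⟩ := existsUnique_sub_zsmul_mem_Ico hT x 0
        exact ⟨_, hm, m, by ring⟩
      have e : (x : AddCircle (2 * Real.pi)) = (y' : AddCircle (2 * Real.pi)) := by
        rw [hm]
        rw [AddCircle.coe_add, AddCircle.coe_zsmul, AddCircle.coe_period]; simp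
      rw [e, hF]
      change AddCircle.liftIco (2 * Real.pi) 0 f y' = _
      rw [AddCircle.liftIco_coe_apply hy', hm]
      exact ((hfp.zsmul m) y').symm
    rw [hx, hFb] at h
    convert! h using 2 with k
    rw [fourier_coe_apply, smul_eq_mul]
    congr 2
    push_cast
    field_simp
  refine ⟨fun k => (b k).re, fun S => ?_, fun x => ?_⟩
  · obtain ⟨C, h0, hC⟩ := hdecay S
    exact ⟨C, h0, fun k => (Complex.abs_re_le_norm _).trans (hC k)⟩
  -- Averaging the series at `x` and `-x` turns the exponentials into cosines, since `G` is even.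
  · have h1 := key x
    have h2 := key (-x)
    have h3 := ((h1.add h2).mul_left (1 / 2 : ℂ))
    have h4 := Complex.hasSum_re h3
    have e : ((1 / 2 : ℂ) * (f x + f (-x))).re = G x := by
      simp only [hf, heven]
      rw [← two_mul, ← mul_assoc]
      norm_num
    rw [e] at h4
    convert! h4 using 2 with k
    have : (1 / 2 : ℂ) * (b k * Complex.exp (k * x * Complex.I) +
        b k * Complex.exp (k * ((-x : ℝ) : ℂ) * Complex.I)) = b k * (Real.cos (k * x) : ℝ) := by
      push_cast
      rw [Complex.cos]
      ring_nf
    rw [this, Complex.re_mul_ofReal]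

end FourierDecay

/-! ### Approximation of a frequency cutoff by sums of Gaussians -/

section Cutoff

/-- The smooth function equal to `1 / s` for `s ≥ 3 / 4` and to `0` for `s ≤ 1 / 2`. -/
noncomputable def cutoffInv (s : ℝ) : ℝ := Real.smoothTransition (4 * s - 2) / s

theorem contDiff_cutoffInv : ContDiff ℝ (⊤ : ℕ∞) cutoffInv := by
  rw [contDiff_iff_contDiffAt]
  intro s
  by_cases hs : s < 1 / 2
  · have : cutoffInv =ᶠ[𝓝 s] fun _ => 0 := by
      filter_upwards [Iio_mem_nhds hs] with t ht
      have ht' : t < 1 / 2 := ht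
      rw [cutoffInv, Real.smoothTransition.zero_of_nonpos (by linarith), zero_div]
    exact contDiffAt_const.congr_of_eventuallyEq this
  · have h1 : ContDiffAt ℝ (⊤ : ℕ∞) (fun t : ℝ => Real.smoothTransition (4 * t - 2)) s :=
      (Real.smoothTransition.contDiff.comp (by fun_prop)).contDiffAt
    exact h1.div contDiffAt_id (by simp; intro h; rw [h] at hs; norm_num at hs)

/-- A cutoff function in the frequency variable, equal to `1` on `[-1/2, 1/2]` and supported in
`[-1, 1]`. -/
noncomputable def freqCutoff (u : ℝ) : ℝ :=
  Real.exp (-u ^ 2) * cutoffInv (Real.exp (-u ^ 2))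

theorem freqCutoff_eq_one {u : ℝ} (hu : |u| ≤ 1 / 2) : freqCutoff u = 1 := by
  have h1 : u ^ 2 ≤ 1 / 4 := by
    rw [← sq_abs]; nlinarith [abs_nonneg u]
  have h2 : 3 / 4 ≤ Real.exp (-u ^ 2) := by
    have := Real.add_one_le_exp (-u ^ 2)
    linarith
  rw [freqCutoff, cutoffInv, Real.smoothTransition.one_of_one_le (by linarith)]
  field_simp

theorem freqCutoff_eq_zero {u : ℝ} (hu : 1 ≤ u) : freqCutoff u = 0 := by
  have h2 : Real.exp (-u ^ 2) ≤ 1 / 2 := by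
    rw [Real.exp_neg]
    have := Real.add_one_le_exp (u ^ 2)
    rw [inv_le_comm₀ (Real.exp_pos _) (by norm_num)]
    nlinarith
  rw [freqCutoff, cutoffInv, Real.smoothTransition.zero_of_nonpos (by linarith)]
  simp

open Polynomial in
/-- The polynomial `T_k(2 X - 1)`. -/
noncomputable def shiftedChebyshev : ℕ → ℝ[X]
  | 0 => 1
  | 1 => 2 * X - 1
  | (k + 2) => 2 * (2 * X - 1) * shiftedChebyshev (k + 1) - shiftedChebyshev k

theorem shiftedChebyshev_eval_cos (θ : ℝ) : ∀ k : ℕ,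
    (shiftedChebyshev k).eval ((1 + Real.cos θ) / 2) = Real.cos (k * θ)
  | 0 => by simp [shiftedChebyshev]
  | 1 => by simp [shiftedChebyshev]; ring
  | (k + 2) => by
    rw [shiftedChebyshev]
    simp only [Polynomial.eval_sub, Polynomial.eval_mul, shiftedChebyshev_eval_cos θ (k + 1),
      shiftedChebyshev_eval_cos θ k, Polynomial.eval_ofNat, Polynomial.eval_X,
      Polynomial.eval_one]
    have h1 : ((k + 2 : ℕ) : ℝ) * θ = ((k + 1 : ℕ) : ℝ) * θ + θ := by push_cast; ring
    have h2 : (k : ℝ) * θ = ((k + 1 : ℕ) : ℝ) * θ - θ := by push_cast; ring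
    rw [h1, h2, Real.cos_add, Real.cos_sub]
    ring

theorem natDegree_shiftedChebyshev_le : ∀ k : ℕ, (shiftedChebyshev k).natDegree ≤ k
  | 0 => by simp [shiftedChebyshev]
  | 1 => by rw [shiftedChebyshev]; compute_degree
  | (k + 2) => by
    have h1 := natDegree_shiftedChebyshev_le (k + 1)
    have h0 := natDegree_shiftedChebyshev_le k
    rw [shiftedChebyshev]
    refine (Polynomial.natDegree_sub_le _ _).trans (max_le ?_ (by omega))
    refine Polynomial.natDegree_mul_le.trans ?_
    have : (2 * (2 * Polynomial.X - 1) : Polynomial ℝ).natDegree ≤ 1 := by compute_degree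
    omega

/-- Multiplication by `4 X - 2` enlarges the `ℓ¹` norm of the coefficients by at most `4 + 2`. -/
theorem sum_abs_coeff_mul_le (p : Polynomial ℝ) {N : ℕ} (hp : p.natDegree < N) :
    ∑ j ∈ Finset.range (N + 1), |(2 * (2 * Polynomial.X - 1) * p).coeff j| ≤
      6 * ∑ j ∈ Finset.range N, |p.coeff j| := by
  have e : 2 * (2 * Polynomial.X - 1) * p = Polynomial.X * (Polynomial.C 4 * p)
      - Polynomial.C 2 * p := by
    simp only [map_ofNat]; ring
  have hN : p.coeff N = 0 := Polynomial.coeff_eq_zero_of_natDegree_lt hp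
  have h1 : ∑ j ∈ Finset.range (N + 1), |(Polynomial.X * (Polynomial.C 4 * p)).coeff j| =
      4 * ∑ j ∈ Finset.range N, |p.coeff j| := by
    rw [Finset.sum_range_succ', Finset.mul_sum]
    simp [Polynomial.coeff_X_mul, abs_mul]
  have h2 : ∑ j ∈ Finset.range (N + 1), |(Polynomial.C 2 * p).coeff j| =
      2 * ∑ j ∈ Finset.range N, |p.coeff j| := by
    rw [Finset.sum_range_succ, Finset.mul_sum]
    simp [abs_mul, hN]
  rw [e]
  calc _ ≤ ∑ j ∈ Finset.range (N + 1), (|(Polynomial.X * (Polynomial.C 4 * p)).coeff j| +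
        |(Polynomial.C 2 * p).coeff j|) := by
        refine Finset.sum_le_sum fun j _ => ?_
        rw [Polynomial.coeff_sub]
        exact abs_sub _ _
    _ = _ := by rw [Finset.sum_add_distrib, h1, h2]; ring

theorem sum_abs_coeff_eq (p : Polynomial ℝ) {N N' : ℕ} (hp : p.natDegree < N) (h : N ≤ N') :
    ∑ j ∈ Finset.range N', |p.coeff j| = ∑ j ∈ Finset.range N, |p.coeff j| := by
  refine (Finset.sum_subset (Finset.range_mono h) fun j _ hj => ?_).symm
  rw [Polynomial.coeff_eq_zero_of_natDegree_lt (by simp at hj; omega), abs_zero]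

/-- The three-term recursion gives norms with `S_{k+2} ≤ 6 S_{k+1} + S_k`, and `6 * 7 + 1 ≤ 7 ^ 2`.
Only an exponential bound matters later, with base less than `exp 3`. -/
theorem sum_abs_coeff_shiftedChebyshev_le : ∀ k : ℕ,
    ∑ j ∈ Finset.range (k + 1), |(shiftedChebyshev k).coeff j| ≤ 7 ^ k
  | 0 => by simp [shiftedChebyshev]
  | 1 => by
    simp [shiftedChebyshev, Finset.sum_range_succ, Polynomial.coeff_one, Polynomial.coeff_X]
    norm_num
  | (k + 2) => by
    have h1 := sum_abs_coeff_shiftedChebyshev_le (k + 1)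
    have h0 := sum_abs_coeff_shiftedChebyshev_le k
    have d1 := natDegree_shiftedChebyshev_le (k + 1)
    have d0 := natDegree_shiftedChebyshev_le k
    rw [shiftedChebyshev]
    calc _ ≤ ∑ j ∈ Finset.range (k + 2 + 1),
          (|(2 * (2 * Polynomial.X - 1) * shiftedChebyshev (k + 1)).coeff j| +
            |(shiftedChebyshev k).coeff j|) := by
          refine Finset.sum_le_sum fun j _ => ?_
          rw [Polynomial.coeff_sub]
          exact abs_sub _ _
      _ ≤ 6 * 7 ^ (k + 1) + 7 ^ k := by
          rw [Finset.sum_add_distrib]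
          refine add_le_add ((sum_abs_coeff_mul_le _ (by omega)).trans (by gcongr)) ?_
          rw [sum_abs_coeff_eq _ (by omega : _ < k + 1) (by omega)]
          exact h0
      _ ≤ 7 ^ (k + 2) := by
          have : (0 : ℝ) < 7 ^ k := by positivity
          have e1 : (7 : ℝ) ^ (k + 1) = 7 * 7 ^ k := by ring
          have e2 : (7 : ℝ) ^ (k + 2) = 49 * 7 ^ k := by ring
          rw [e1, e2]; linarith

/-- Approximation of the cutoff function by short sums of Gaussians, with rapidly decreasing error
and exponentially bounded coefficients. -/
theorem exists_gaussian_approx (S : ℕ) : ∃ C : ℝ, 0 < C ∧ ∀ J : ℕ, ∃ a : ℕ → ℝ,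
    ∑ j ∈ Finset.range J, |a j| ≤ C * 7 ^ J ∧
    ∀ u : ℝ, |freqCutoff u - ∑ j ∈ Finset.range J, a j * Real.exp (-((j + 1) * u ^ 2))| ≤
      C / (J + 1) ^ S * Real.exp (-u ^ 2) := by
  -- The substitution `s = (1 + cos θ) / 2` makes `cutoffInv` a smooth even periodic function. Its
  -- cosine series is the expansion in the polynomials `T_k(2 s - 1)`.
  set G : ℝ → ℝ := fun θ => cutoffInv ((1 + Real.cos θ) / 2) with hG
  have hGs : ContDiff ℝ (⊤ : ℕ∞) G :=
    contDiff_cutoffInv.comp ((contDiff_const.add Real.contDiff_cos).div_const 2)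
  obtain ⟨c, hc, hsum⟩ := exists_cosine_series hGs (fun x => by simp [hG])
    (fun x => by simp [hG])
  -- Two powers pay for summability over `k`; the other `S` give the rate.
  obtain ⟨C, hC0, hC⟩ := hc (S + 2)
  have hsum2 : Summable fun k : ℤ => (1 : ℝ) / (|(k : ℝ)| + 1) ^ 2 := by
    have h2 : Summable fun k : ℤ => 1 / |(k : ℝ)| ^ 2 := by
      simpa using Real.summable_one_div_int_pow.2 (le_refl 2)
    refine h2.of_norm_bounded_eventually ?_
    have : ∀ᶠ k : ℤ in cofinite, k ≠ 0 := (finite_singleton (0 : ℤ)).compl_mem_cofinite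
    filter_upwards [this] with k hk
    have h1 : 0 < |(k : ℝ)| := by positivity
    rw [Real.norm_of_nonneg (by positivity)]
    gcongr
    linarith
  set D := ∑' k : ℤ, (1 : ℝ) / (|(k : ℝ)| + 1) ^ 2 with hD
  have hD1 : 0 < D := hsum2.tsum_pos (fun k => by positivity) 0 (by positivity)
  refine ⟨C * D, by positivity, fun J => ?_⟩
  -- Frequencies `|k| < J` give a polynomial in `s` of degree less than `J`. The factor `s` pulled
  -- out of `freqCutoff` turns `s ^ j` into the Gaussian `exp (-(j + 1) u²)` and leaves a factor
  -- `exp (-u²)` in the error, which later makes the error summable over the spectrum.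
  set I : Finset ℤ := Finset.Ioo (-J : ℤ) J with hI
  have hIJ : ∀ k ∈ I, k.natAbs < J := fun k hk => by rw [hI, Finset.mem_Ioo] at hk; omega
  have hck : ∀ k, |c k| ≤ C * (1 / (|(k : ℝ)| + 1) ^ 2) := fun k => by
    refine (hC k).trans ?_
    rw [mul_one_div]
    gcongr
    · linarith [abs_nonneg (k : ℝ)]
    · omega
  refine ⟨fun j => ∑ k ∈ I, c k * (shiftedChebyshev k.natAbs).coeff j, ?_, fun u => ?_⟩
  · calc _ ≤ ∑ j ∈ Finset.range J, ∑ k ∈ I, |c k| * |(shiftedChebyshev k.natAbs).coeff j| := by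
          refine Finset.sum_le_sum fun j _ => (Finset.abs_sum_le_sum_abs _ _).trans_eq ?_
          simp_rw [abs_mul]
      _ = ∑ k ∈ I, |c k| * ∑ j ∈ Finset.range J, |(shiftedChebyshev k.natAbs).coeff j| := by
          rw [Finset.sum_comm]; simp_rw [Finset.mul_sum]
      _ ≤ ∑ k ∈ I, (C * (1 / (|(k : ℝ)| + 1) ^ 2)) * 7 ^ J := by
          refine Finset.sum_le_sum fun k hk => ?_
          have hk' := hIJ k hk
          have d := natDegree_shiftedChebyshev_le k.natAbs
          gcongr
          · exact hck k
          · rw [sum_abs_coeff_eq _ (by omega : _ < k.natAbs + 1) (by omega)]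
            refine (sum_abs_coeff_shiftedChebyshev_le _).trans ?_
            gcongr
            norm_num
      _ = C * (∑ k ∈ I, 1 / (|(k : ℝ)| + 1) ^ 2) * 7 ^ J := by
          rw [← Finset.sum_mul, ← Finset.mul_sum]
      _ ≤ C * D * 7 ^ J := by
          gcongr
          exact hsum2.sum_le_tsum _ (fun k _ => by positivity)
  · set s := Real.exp (-u ^ 2) with hs
    have hs0 : 0 < s := Real.exp_pos _
    have hs1 : s ≤ 1 := Real.exp_le_one_iff.2 (by nlinarith [sq_nonneg u])
    set θ := Real.arccos (2 * s - 1) with hθ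
    have hcos : (1 + Real.cos θ) / 2 = s := by
      rw [hθ, Real.cos_arccos (by linarith) (by linarith)]; ring
    have hGθ : G θ = cutoffInv s := by simp only [hG, hcos]
    have e1 : ∑ j ∈ Finset.range J, (∑ k ∈ I, c k * (shiftedChebyshev k.natAbs).coeff j) *
        Real.exp (-((j + 1) * u ^ 2)) = s * ∑ k ∈ I, c k * Real.cos (k * θ) := by
      have : ∀ k ∈ I, c k * Real.cos (k * θ) =
          ∑ j ∈ Finset.range J, c k * ((shiftedChebyshev k.natAbs).coeff j * s ^ j) := by
        intro k hk
        have hk' := hIJ k hk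
        have d := natDegree_shiftedChebyshev_le k.natAbs
        rw [← Finset.mul_sum, ← Polynomial.eval_eq_sum_range' (by omega), ← hcos,
          shiftedChebyshev_eval_cos]
        congr 1
        rw [Nat.cast_natAbs, Int.cast_abs]
        rcases abs_choice (k : ℝ) with h | h <;> rw [h]
        rw [neg_mul, Real.cos_neg]
      rw [Finset.sum_congr rfl this, Finset.sum_comm, Finset.mul_sum]
      refine Finset.sum_congr rfl fun j _ => ?_
      rw [Finset.sum_mul, Finset.mul_sum]
      refine Finset.sum_congr rfl fun k _ => ?_
      have : Real.exp (-((j + 1) * u ^ 2)) = s * s ^ j := by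
        rw [hs, ← Real.exp_nat_mul, ← Real.exp_add]; congr 1; ring
      rw [this]; ring
    rw [e1, freqCutoff, ← hs, ← hGθ, ← mul_sub, abs_mul, abs_of_pos hs0, mul_comm]
    refine mul_le_mul_of_nonneg_right ?_ hs0.le
    have h1 : HasSum (fun k : ℤ => if k ∈ I then 0 else c k * Real.cos (k * θ))
        (G θ - ∑ k ∈ I, c k * Real.cos (k * θ)) := by
      have h2 : HasSum (fun k : ℤ => if k ∈ I then c k * Real.cos (k * θ) else 0)
          (∑ k ∈ I, c k * Real.cos (k * θ)) := by
        have : HasSum (fun k : ℤ => if k ∈ I then c k * Real.cos (k * θ) else 0)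
            (∑ k ∈ I, if k ∈ I then c k * Real.cos (k * θ) else 0) :=
          hasSum_sum_of_ne_finset_zero (fun b hb => by simp [hb])
        rwa [Finset.sum_congr rfl (fun k hk => if_pos hk)] at this
      convert! (hsum θ).sub h2 using 2 with k
      by_cases hk : k ∈ I <;> simp [hk]
    have hbd : ∀ k : ℤ, ‖(if k ∈ I then 0 else c k * Real.cos (k * θ))‖ ≤
        C / (J + 1) ^ S * (1 / (|(k : ℝ)| + 1) ^ 2) := by
      intro k
      by_cases hk : k ∈ I
      · simp only [hk, if_true, norm_zero]; positivity
      · simp only [hk, if_false]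
        have hkJ : (J : ℝ) ≤ |(k : ℝ)| := by
          have : (J : ℤ) ≤ |k| := by
            rw [hI, Finset.mem_Ioo] at hk
            rcases abs_cases k with h | h <;> omega
          exact_mod_cast this
        rw [Real.norm_eq_abs, abs_mul]
        calc |c k| * |Real.cos (k * θ)| ≤ C / (|(k : ℝ)| + 1) ^ (S + 2) * 1 := by
              gcongr
              · exact hC k
              · exact Real.abs_cos_le_one _
          _ = C / (|(k : ℝ)| + 1) ^ S * (1 / (|(k : ℝ)| + 1) ^ 2) := by
              rw [pow_add]; field_simp
          _ ≤ _ := by gcongr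
    rw [← h1.tsum_eq, ← Real.norm_eq_abs]
    refine (tsum_of_norm_bounded (hsum2.hasSum.mul_left _) hbd).trans_eq ?_
    rw [← hD]; ring

end Cutoff

/-! ### Diffusion polynomials and reproducing kernels -/

theorem ZeroAtInftyContinuousMap.abs_apply_le_norm {X : Type*} [TopologicalSpace X]
    (f : C₀(X, ℝ)) (x : X) : |f x| ≤ ‖f‖ :=
  f.toBCF.norm_coe_le_norm x

theorem ZeroAtInftyContinuousMap.norm_le_of_forall {X : Type*} [TopologicalSpace X]
    (f : C₀(X, ℝ)) {C : ℝ} (hC : 0 ≤ C) (h : ∀ x, |f x| ≤ C) : ‖f‖ ≤ C :=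
  (BoundedContinuousFunction.norm_le hC).2 h

/-- Puts the exponentially small heat-kernel term in the same form as the Chebyshev truncation
error. -/
theorem exp_neg_nat_le (S J : ℕ) :
    Real.exp (-(J : ℝ)) ≤ Real.exp 1 * S.factorial / ((J : ℝ) + 1) ^ S := by
  have h := Real.pow_div_factorial_le_exp ((J : ℝ) + 1) (by positivity) S
  rw [div_le_iff₀ (by positivity), Real.exp_add] at h
  rw [le_div_iff₀ (by positivity), Real.exp_neg]
  calc _ ≤ (Real.exp J)⁻¹ * (Real.exp J * Real.exp 1 * S.factorial) := by gcongr
    _ = _ := by field_simp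

namespace DataSpace

variable {X : Type*} [MetricSpace X] [ConnectedSpace X] [ProperSpace X]
  [MeasurableSpace X] [BorelSpace X]

theorem finite_lam_lt (Ξ : DataSpace X) (m : ℝ) : {k | Ξ.lam k < m}.Finite := by
  have h := Ξ.lam_tendsto.eventually_ge_atTop m
  rw [← Nat.cofinite_eq_atTop, Filter.eventually_cofinite] at h
  simpa using h

theorem lam_nonneg (Ξ : DataSpace X) (k : ℕ) : 0 ≤ Ξ.lam k := by
  rw [← Ξ.lam_zero]; exact Ξ.lam_mono (Nat.zero_le k)

/-- The finite set of indices `k` with `λ_k < m`. -/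
noncomputable def freqSet (Ξ : DataSpace X) (m : ℝ) : Finset ℕ := (Ξ.finite_lam_lt m).toFinset

@[simp] theorem mem_freqSet (Ξ : DataSpace X) {m : ℝ} {k : ℕ} :
    k ∈ Ξ.freqSet m ↔ Ξ.lam k < m := by simp [freqSet]

theorem christoffelSum_eq (Ξ : DataSpace X) (m : ℝ) (x : X) :
    christoffelSum Ξ.lam (fun k x => Ξ.phi k x) m x = ∑ k ∈ Ξ.freqSet m, Ξ.phi k x ^ 2 := by
  exact finsum_mem_eq_finite_toFinset_sum (s := {k | Ξ.lam k < m}) _ (Ξ.finite_lam_lt m)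

/-- The kernel `∑_{λ_k < m} b_k φ_k(x) φ_k(y)`. -/
noncomputable def kernelOf (Ξ : DataSpace X) (b : ℕ → ℝ) (m : ℝ) (x y : X) : ℝ :=
  ∑ k ∈ Ξ.freqSet m, b k * (Ξ.phi k x * Ξ.phi k y)

/-- The localized kernel `∑_k h(λ_k / m) φ_k(x) φ_k(y)` with the cutoff function `h`. -/
noncomputable def kernel (Ξ : DataSpace X) (m : ℝ) (x y : X) : ℝ :=
  Ξ.kernelOf (fun k => freqCutoff (Ξ.lam k / m)) m x y

theorem kernelOf_comm (Ξ : DataSpace X) (b : ℕ → ℝ) (m : ℝ) (x y : X) :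
    Ξ.kernelOf b m x y = Ξ.kernelOf b m y x := by
  simp only [kernelOf, mul_comm]

theorem continuous_kernelOf (Ξ : DataSpace X) (b : ℕ → ℝ) (m : ℝ) :
    Continuous fun p : X × X => Ξ.kernelOf b m p.1 p.2 := by
  unfold kernelOf
  refine continuous_finsetSum _ fun k _ => ?_
  have := (Ξ.phi k).continuous
  fun_prop

theorem exists_poly_eq_kernelOf (Ξ : DataSpace X) (b : ℕ → ℝ) (m : ℝ) (y : X) :
    ∃ P ∈ Ξ.poly m, ∀ x, P x = Ξ.kernelOf b m x y := by
  refine ⟨∑ k ∈ Ξ.freqSet m, (b k * Ξ.phi k y) • Ξ.phi k, ?_, fun x => ?_⟩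
  · refine Submodule.sum_mem _ fun k hk => Submodule.smul_mem _ _ (Submodule.subset_span ?_)
    exact ⟨k, Ξ.mem_freqSet.1 hk, rfl⟩
  · have : ∀ s : Finset ℕ, (∑ k ∈ s, (b k * Ξ.phi k y) • Ξ.phi k : C₀(X, ℝ)) x =
        ∑ k ∈ s, b k * (Ξ.phi k x * Ξ.phi k y) := by
      intro s
      classical
      induction s using Finset.induction_on with
      | empty => simp
      | insert a s ha ih =>
        rw [Finset.sum_insert ha, Finset.sum_insert ha, ZeroAtInftyContinuousMap.add_apply, ih,
          ZeroAtInftyContinuousMap.smul_apply, smul_eq_mul]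
        ring
    exact this _

theorem integrable_of_mem_poly (Ξ : DataSpace X) {n : ℝ} {P : C₀(X, ℝ)} (hP : P ∈ Ξ.poly n) :
    Integrable (fun x => P x) Ξ.μ := by
  induction hP using Submodule.span_induction with
  | mem P h => obtain ⟨k, _, rfl⟩ := h; exact Ξ.phi_integrable k
  | zero => exact integrable_zero _ _ _
  | add P Q _ _ h1 h2 => exact h1.add h2
  | smul a P _ h => exact h.smul a

theorem integrable_mul_of_mem_poly (Ξ : DataSpace X) {n : ℝ} {P : C₀(X, ℝ)} (hP : P ∈ Ξ.poly n)
    (f : C₀(X, ℝ)) : Integrable (fun x => f x * P x) Ξ.μ :=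
  (Ξ.integrable_of_mem_poly hP).bdd_mul f.continuous.aestronglyMeasurable
    (ae_of_all _ fun x => f.abs_apply_le_norm x)

theorem poly_mono (Ξ : DataSpace X) {n m : ℝ} (h : n ≤ m) : Ξ.poly n ≤ Ξ.poly m :=
  Submodule.span_mono (image_mono fun _ hk => lt_of_lt_of_le hk h)

/-- By orthonormality the kernel acts as a multiplier, and the multiplier is `1` on the frequencies
of `P`. -/
theorem integral_kernelOf_mul (Ξ : DataSpace X) {b : ℕ → ℝ} {n m : ℝ} (hnm : n ≤ m)
    (hb : ∀ k, Ξ.lam k < n → b k = 1) {P : C₀(X, ℝ)} (hP : P ∈ Ξ.poly n) (x : X) :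
    ∫ y, Ξ.kernelOf b m x y * P y ∂Ξ.μ = P x := by
  have e : ∀ P ∈ Ξ.poly n, ∫ y, Ξ.kernelOf b m x y * P y ∂Ξ.μ =
      ∑ k ∈ Ξ.freqSet m, b k * Ξ.phi k x * ∫ y, Ξ.phi k y * P y ∂Ξ.μ := by
    intro P hP
    simp_rw [kernelOf, Finset.sum_mul, ← integral_const_mul]
    rw [integral_finsetSum]
    · refine Finset.sum_congr rfl fun k _ => integral_congr_ae (ae_of_all _ fun y => ?_)
      simp only; ring
    · intro k _
      have := (Ξ.integrable_mul_of_mem_poly hP (Ξ.phi k)).const_mul (b k * Ξ.phi k x)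
      refine this.congr (ae_of_all _ fun y => ?_)
      simp only; ring
  rw [e P hP]
  induction hP using Submodule.span_induction with
  | mem P h =>
    obtain ⟨j, hj, rfl⟩ := h
    simp_rw [Ξ.phi_orthonormal]
    have hj' : j ∈ Ξ.freqSet m := Ξ.mem_freqSet.2 (lt_of_lt_of_le hj hnm)
    simp [hj', hb j hj]
  | zero => simp
  | add P Q hP hQ h1 h2 =>
    rw [ZeroAtInftyContinuousMap.add_apply, ← h1, ← h2, ← Finset.sum_add_distrib]
    refine Finset.sum_congr rfl fun k _ => ?_
    simp_rw [ZeroAtInftyContinuousMap.add_apply, mul_add]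
    rw [integral_add (Ξ.integrable_mul_of_mem_poly hP _) (Ξ.integrable_mul_of_mem_poly hQ _)]
    ring
  | smul a P hP h =>
    rw [ZeroAtInftyContinuousMap.smul_apply, ← h, smul_eq_mul, Finset.mul_sum]
    refine Finset.sum_congr rfl fun k _ => ?_
    simp_rw [ZeroAtInftyContinuousMap.smul_apply, smul_eq_mul]
    rw [← integral_const_mul, ← integral_const_mul, ← integral_const_mul]
    refine integral_congr_ae (ae_of_all _ fun y => ?_)
    simp only; ring

theorem integral_kernel_mul (Ξ : DataSpace X) {n m : ℝ} (hm : 0 < m) (hnm : 2 * n ≤ m)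
    {P : C₀(X, ℝ)} (hP : P ∈ Ξ.poly n) (x : X) :
    ∫ y, Ξ.kernel m x y * P y ∂Ξ.μ = P x := by
  have hn : n ≤ m := by
    rcases le_or_gt n 0 with h | h <;> linarith
  refine Ξ.integral_kernelOf_mul hn (fun k hk => freqCutoff_eq_one ?_) hP x
  have := Ξ.lam_nonneg k
  rw [abs_of_nonneg (by positivity), div_le_iff₀ hm]
  linarith

/-! ### Heat kernel bounds and localization of the smooth kernel -/

section Heat

theorem heat_diag (Ξ : DataSpace X) {m : ℝ} (hm : 1 ≤ m) (x : X) :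
    Summable (fun k => Real.exp (-(Ξ.lam k / m) ^ 2) * Ξ.phi k x ^ 2) ∧
      ∑' k, Real.exp (-(Ξ.lam k / m) ^ 2) * Ξ.phi k x ^ 2 ≤ Ξ.κ₁ * m ^ Ξ.q := by
  have hm0 : 0 < m := by linarith
  obtain ⟨h1, h2⟩ := Ξ.gaussian_bound x x (1 / m ^ 2) (by positivity)
    (by rw [div_le_one (by positivity)]; nlinarith)
  have e : (fun k => Real.exp (-(Ξ.lam k ^ 2) * (1 / m ^ 2)) * Ξ.phi k x * Ξ.phi k x) =
      fun k => Real.exp (-(Ξ.lam k / m) ^ 2) * Ξ.phi k x ^ 2 := by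
    ext k
    rw [mul_assoc, ← sq]
    congr 2
    field_simp
  rw [e] at h1 h2
  refine ⟨h1, (le_abs_self _).trans (h2.trans_eq ?_)⟩
  have : (1 / m ^ 2) ^ (-(Ξ.q / 2)) = m ^ Ξ.q := by
    rw [one_div, ← Real.rpow_natCast, ← Real.rpow_neg hm0.le, ← Real.rpow_mul hm0.le]
    congr 1; push_cast; ring
  rw [this]; simp

/-- The arithmetic–geometric mean inequality reduces absolute convergence off the diagonal to the
diagonal bounds. -/
theorem heat_abs (Ξ : DataSpace X) {m : ℝ} (hm : 1 ≤ m) (x y : X) :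
    Summable (fun k => Real.exp (-(Ξ.lam k / m) ^ 2) * |Ξ.phi k x * Ξ.phi k y|) ∧
      ∑' k, Real.exp (-(Ξ.lam k / m) ^ 2) * |Ξ.phi k x * Ξ.phi k y| ≤ Ξ.κ₁ * m ^ Ξ.q := by
  obtain ⟨sx, bx⟩ := Ξ.heat_diag hm x
  obtain ⟨sy, bvy⟩ := Ξ.heat_diag hm y
  have s := (sx.add sy).mul_left (1 / 2)
  have hle : ∀ k, Real.exp (-(Ξ.lam k / m) ^ 2) * |Ξ.phi k x * Ξ.phi k y| ≤
      1 / 2 * (Real.exp (-(Ξ.lam k / m) ^ 2) * Ξ.phi k x ^ 2 +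
        Real.exp (-(Ξ.lam k / m) ^ 2) * Ξ.phi k y ^ 2) := by
    intro k
    have : |Ξ.phi k x * Ξ.phi k y| ≤ 1 / 2 * (Ξ.phi k x ^ 2 + Ξ.phi k y ^ 2) := by
      rw [abs_le]
      constructor <;> nlinarith [sq_nonneg (Ξ.phi k x + Ξ.phi k y),
        sq_nonneg (Ξ.phi k x - Ξ.phi k y)]
    calc _ ≤ Real.exp (-(Ξ.lam k / m) ^ 2) * (1 / 2 * (Ξ.phi k x ^ 2 + Ξ.phi k y ^ 2)) := by gcongr
      _ = _ := by ring
  have s' := Summable.of_nonneg_of_le (fun k => by positivity) hle s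
  refine ⟨s', (s'.tsum_le_tsum hle s).trans ?_⟩
  rw [tsum_mul_left, sx.tsum_add sy]
  linarith

/-- On the frequencies below `m` the heat multiplier at time `1 / m²` is at least `exp (-1)`. -/
theorem christoffel_le (Ξ : DataSpace X) {m : ℝ} (hm : 1 ≤ m) (x : X) :
    ∑ k ∈ Ξ.freqSet m, Ξ.phi k x ^ 2 ≤ Real.exp 1 * (Ξ.κ₁ * m ^ Ξ.q) := by
  obtain ⟨s, b⟩ := Ξ.heat_diag hm x
  calc _ ≤ ∑ k ∈ Ξ.freqSet m, Real.exp 1 * (Real.exp (-(Ξ.lam k / m) ^ 2) * Ξ.phi k x ^ 2) := by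
        refine Finset.sum_le_sum fun k hk => ?_
        have h0 := Ξ.lam_nonneg k
        have h1 := Ξ.mem_freqSet.1 hk
        have h2 : Ξ.lam k / m ≤ 1 := by rw [div_le_one (by linarith)]; exact h1.le
        have h3 : 0 ≤ Ξ.lam k / m := by positivity
        rw [← mul_assoc, ← Real.exp_add]
        refine le_mul_of_one_le_left (sq_nonneg _) (Real.one_le_exp ?_)
        nlinarith
    _ = Real.exp 1 * ∑ k ∈ Ξ.freqSet m, Real.exp (-(Ξ.lam k / m) ^ 2) * Ξ.phi k x ^ 2 := by
        rw [Finset.mul_sum]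
    _ ≤ _ := by
        gcongr
        exact (s.sum_le_tsum _ (fun k _ => by positivity)).trans b

/-- This is the Gaussian bound at time `(j + 1) / m²`, which lies in the admissible range because `J
≤ m ^ 2`. Replacing `j + 1` by `J` in the exponent makes the bound uniform in `j`. -/
theorem heat_offdiag (Ξ : DataSpace X) {m : ℝ} (hm : 1 ≤ m) {J : ℕ} (hJ : (J : ℝ) ≤ m ^ 2) (j : ℕ)
    (hj : j < J) (x y : X) :
    Summable (fun k => Real.exp (-((j + 1) * (Ξ.lam k / m) ^ 2)) * (Ξ.phi k x * Ξ.phi k y)) ∧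
      |∑' k, Real.exp (-((j + 1) * (Ξ.lam k / m) ^ 2)) * (Ξ.phi k x * Ξ.phi k y)| ≤
        Ξ.κ₁ * m ^ Ξ.q * Real.exp (-(Ξ.κ₂ * (m * dist x y) ^ 2 / J)) := by
  have hm0 : 0 < m := by linarith
  have hq := Ξ.one_le_q
  have hκ := Ξ.κ₁_pos
  have hκ2 := Ξ.κ₂_pos
  have hjJ : (j : ℝ) + 1 ≤ J := by exact_mod_cast hj
  have hJ0 : (0 : ℝ) < J := by exact_mod_cast Nat.zero_lt_of_lt hj
  obtain ⟨h1, h2⟩ := Ξ.gaussian_bound x y ((j + 1) / m ^ 2) (by positivity)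
    (by rw [div_le_one (by positivity)]; linarith)
  have e : (fun k => Real.exp (-(Ξ.lam k ^ 2) * ((j + 1) / m ^ 2)) * Ξ.phi k x * Ξ.phi k y) =
      fun k => Real.exp (-((j + 1) * (Ξ.lam k / m) ^ 2)) * (Ξ.phi k x * Ξ.phi k y) := by
    ext k
    rw [mul_assoc]
    congr 2
    field_simp
  rw [e] at h1 h2
  refine ⟨h1, h2.trans ?_⟩
  have : (((j : ℝ) + 1) / m ^ 2) ^ (-(Ξ.q / 2)) ≤ m ^ Ξ.q := by
    calc (((j : ℝ) + 1) / m ^ 2) ^ (-(Ξ.q / 2)) ≤ (1 / m ^ 2) ^ (-(Ξ.q / 2)) := by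
          apply Real.rpow_le_rpow_of_nonpos (by positivity)
          · gcongr; linarith [(Nat.cast_nonneg j : (0 : ℝ) ≤ j)]
          · linarith
      _ = m ^ Ξ.q := by
          rw [one_div, ← Real.rpow_natCast, ← Real.rpow_neg hm0.le, ← Real.rpow_mul hm0.le]
          congr 1; push_cast; ring
  gcongr
  calc Ξ.κ₂ * (m * dist x y) ^ 2 / J ≤ Ξ.κ₂ * (m * dist x y) ^ 2 / (j + 1) := by gcongr
    _ = _ := by field_simp

/-- The kernel is a combination of `J` heat kernels plus an error controlled by `heat_abs`. The
second condition on `J` makes the Gaussian exponent at least `4 J`, which beats the coefficient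
growth `7 ^ J ≤ exp (3 J)`. -/
theorem abs_kernel_le_aux (Ξ : DataSpace X) (S : ℕ) : ∃ C : ℝ, 0 < C ∧
    ∀ m : ℝ, 1 ≤ m → ∀ x y : X, ∀ J : ℕ, (J : ℝ) ≤ m ^ 2 →
      (J : ℝ) ≤ √Ξ.κ₂ / 2 * (m * dist x y) →
      |Ξ.kernel m x y| ≤ C * m ^ Ξ.q / (J + 1) ^ S := by
  obtain ⟨C, hC0, hC⟩ := exists_gaussian_approx S
  have hκ := Ξ.κ₁_pos
  have hκ2 := Ξ.κ₂_pos
  refine ⟨Ξ.κ₁ * C * (Real.exp 1 * S.factorial + 1), by positivity, ?_⟩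
  intro m hm x y J hJm hJd
  have hm0 : 0 < m := by linarith
  obtain ⟨a, ha, happ⟩ := hC J
  set v : ℕ → ℝ := fun k => Ξ.phi k x * Ξ.phi k y with hv
  set u : ℕ → ℝ := fun k => Ξ.lam k / m with hu
  obtain ⟨sabs, babs⟩ := Ξ.heat_abs hm x y
  have hker : HasSum (fun k => freqCutoff (u k) * v k) (Ξ.kernel m x y) := by
    refine hasSum_sum_of_ne_finset_zero fun k hk => ?_
    rw [mem_freqSet, not_lt] at hk
    rw [freqCutoff_eq_zero, zero_mul]
    rwa [hu, one_le_div hm0]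
  set w : ℕ → ℝ := fun j => ∑' k, Real.exp (-((j + 1) * u k ^ 2)) * v k with hw
  have hheat : HasSum (fun k => ∑ j ∈ Finset.range J, a j * (Real.exp (-((j + 1) * u k ^ 2)) * v k))
      (∑ j ∈ Finset.range J, a j * w j) := by
    refine hasSum_sum fun j hj => ?_
    exact ((Ξ.heat_offdiag hm hJm j (Finset.mem_range.1 hj) x y).1.hasSum).mul_left _
  have herr := hker.sub hheat
  have hE : |Ξ.kernel m x y - ∑ j ∈ Finset.range J, a j * w j| ≤
      C / (J + 1) ^ S * (Ξ.κ₁ * m ^ Ξ.q) := by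
    rw [← herr.tsum_eq, ← Real.norm_eq_abs]
    refine (tsum_of_norm_bounded (sabs.hasSum.mul_left (C / (J + 1) ^ S)) fun k => ?_).trans ?_
    · have : freqCutoff (u k) * v k - ∑ j ∈ Finset.range J,
          a j * (Real.exp (-((j + 1) * u k ^ 2)) * v k) =
          (freqCutoff (u k) - ∑ j ∈ Finset.range J, a j * Real.exp (-((j + 1) * u k ^ 2))) * v k := by
        rw [sub_mul, Finset.sum_mul]; simp_rw [mul_assoc]
      rw [this, norm_mul, Real.norm_eq_abs, Real.norm_eq_abs, ← mul_assoc]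
      gcongr
      exact happ (u k)
    · gcongr
  have hM : |∑ j ∈ Finset.range J, a j * w j| ≤
      Ξ.κ₁ * m ^ Ξ.q * (C * (Real.exp 1 * S.factorial / (J + 1) ^ S)) := by
    rcases Nat.eq_zero_or_pos J with h0 | hJ
    · subst h0; simp; positivity
    have hJ0 : (0 : ℝ) < J := by positivity
    have hd : 4 * (J : ℝ) ≤ Ξ.κ₂ * (m * dist x y) ^ 2 / J := by
      rw [le_div_iff₀ hJ0]
      have h1 : (J : ℝ) ^ 2 ≤ (√Ξ.κ₂ / 2 * (m * dist x y)) ^ 2 := by gcongr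
      have h2 : (√Ξ.κ₂) ^ 2 = Ξ.κ₂ := Real.sq_sqrt hκ2.le
      rw [mul_pow, div_pow, h2] at h1
      nlinarith
    calc _ ≤ ∑ j ∈ Finset.range J, |a j| * (Ξ.κ₁ * m ^ Ξ.q * Real.exp (-(4 * J))) := by
          refine (Finset.abs_sum_le_sum_abs _ _).trans (Finset.sum_le_sum fun j hj => ?_)
          rw [abs_mul]
          gcongr
          refine (Ξ.heat_offdiag hm hJm j (Finset.mem_range.1 hj) x y).2.trans ?_
          gcongr
      _ ≤ (C * 7 ^ J) * (Ξ.κ₁ * m ^ Ξ.q * Real.exp (-(4 * J))) := by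
          rw [← Finset.sum_mul]; gcongr
      _ ≤ (C * Real.exp (3 * J)) * (Ξ.κ₁ * m ^ Ξ.q * Real.exp (-(4 * J))) := by
          have h7 : (7 : ℝ) ≤ Real.exp 3 := by
            have h1 := Real.exp_one_gt_d9
            have : Real.exp 3 = Real.exp 1 ^ 3 := by rw [← Real.exp_nat_mul]; norm_num
            rw [this]
            calc (7 : ℝ) ≤ 2 ^ 3 := by norm_num
              _ ≤ _ := by gcongr; linarith
          have : (7 : ℝ) ^ J ≤ Real.exp (3 * J) := by
            rw [mul_comm, Real.exp_nat_mul]; gcongr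
          gcongr
      _ = Ξ.κ₁ * m ^ Ξ.q * (C * Real.exp (-J)) := by
          have : Real.exp (-(J : ℝ)) = Real.exp (3 * J) * Real.exp (-(4 * J)) := by
            rw [← Real.exp_add]; congr 1; ring
          rw [this]; ring
      _ ≤ _ := by gcongr; exact exp_neg_nat_le S J
  calc |Ξ.kernel m x y| ≤ |Ξ.kernel m x y - ∑ j ∈ Finset.range J, a j * w j| +
        |∑ j ∈ Finset.range J, a j * w j| := by
        have := abs_add_le (Ξ.kernel m x y - ∑ j ∈ Finset.range J, a j * w j)
          (∑ j ∈ Finset.range J, a j * w j)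
        simpa using this
    _ ≤ _ := add_le_add hE hM
    _ = _ := by ring

/-- The localization profile `m^q ((1 + m ρ)^{-S} + m^{-S})`. -/
noncomputable def profile (Ξ : DataSpace X) (S : ℕ) (m : ℝ) (r : ℝ) : ℝ :=
  m ^ Ξ.q * (1 / (1 + m * r) ^ S + 1 / m ^ S)

/-- Take `J` as large as `abs_kernel_le_aux` permits. If the distance limits `J`, the decay is in `1
+ m ρ`; if the restriction to times at most `1` does, then `J + 1 > m ^ 2 ≥ m`, which yields the
distance-independent term `m ^ (-S)` of the profile. -/
theorem abs_kernel_le (Ξ : DataSpace X) (S : ℕ) : ∃ C : ℝ, 0 < C ∧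
    ∀ m : ℝ, 1 ≤ m → ∀ x y : X, |Ξ.kernel m x y| ≤ C * Ξ.profile S m (dist x y) := by
  obtain ⟨C, hC0, hC⟩ := Ξ.abs_kernel_le_aux S
  have hκ2 := Real.sqrt_pos.2 Ξ.κ₂_pos
  set c := √Ξ.κ₂ / 2 with hc
  have hc0 : 0 < c := by positivity
  set d := min 1 c / 2 with hd
  have hd0 : 0 < d := by positivity
  refine ⟨C * max 1 (1 / d ^ S), by positivity, fun m hm x y => ?_⟩
  have hm0 : 0 < m := by linarith
  set r := m * dist x y with hr
  have hr0 : 0 ≤ r := by positivity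
  set J := ⌊min (c * r) (m ^ 2)⌋₊ with hJ
  have hJ0 : (J : ℝ) ≤ min (c * r) (m ^ 2) := Nat.floor_le (by positivity)
  have hJ1 : min (c * r) (m ^ 2) < J + 1 := Nat.lt_floor_add_one _
  have h := hC m hm x y J (hJ0.trans (min_le_right _ _)) (hJ0.trans (min_le_left _ _))
  refine h.trans ?_
  have hJn : (0 : ℝ) ≤ J := by positivity
  have key : 1 / ((J : ℝ) + 1) ^ S ≤ max 1 (1 / d ^ S) * (1 / (1 + r) ^ S + 1 / m ^ S) := by
    rcases le_total (c * r) (m ^ 2) with hle | hle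
    · rw [min_eq_left hle] at hJ1
      have h1 : d * (1 + r) ≤ J + 1 := by
        have a1 : d ≤ 1 / 2 := by rw [hd]; linarith [min_le_left 1 c]
        have a2 : d ≤ c / 2 := by rw [hd]; linarith [min_le_right 1 c]
        nlinarith
      calc 1 / ((J : ℝ) + 1) ^ S ≤ 1 / (d * (1 + r)) ^ S := by gcongr
        _ = 1 / d ^ S * (1 / (1 + r) ^ S) := by rw [mul_pow]; field_simp
        _ ≤ max 1 (1 / d ^ S) * (1 / (1 + r) ^ S + 1 / m ^ S) := by
            gcongr
            · exact le_max_right _ _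
            · have : 0 < 1 / m ^ S := by positivity
              linarith
    · rw [min_eq_right hle] at hJ1
      have h1 : m ≤ J + 1 := by nlinarith
      calc 1 / ((J : ℝ) + 1) ^ S ≤ 1 * (1 / m ^ S) := by rw [one_mul]; gcongr
        _ ≤ max 1 (1 / d ^ S) * (1 / (1 + r) ^ S + 1 / m ^ S) := by
            gcongr
            · exact le_max_left _ _
            · have : 0 < 1 / (1 + r) ^ S := by positivity
              linarith
  calc C * m ^ Ξ.q / (J + 1) ^ S = C * m ^ Ξ.q * (1 / (J + 1) ^ S) := by ring
    _ ≤ C * m ^ Ξ.q * (max 1 (1 / d ^ S) * (1 / (1 + r) ^ S + 1 / m ^ S)) := by gcongr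
    _ = _ := by rw [profile]; ring

end Heat

end DataSpace

/-! ### Integral estimates for the kernel and mass outside `K_{2n}` -/

/-- The tail `∑_{i ≥ L} (i + 1)^{-2}`. -/
noncomputable def invSqTail (L : ℕ) : ℝ := ∑' i : ℕ, 1 / ((i + L : ℕ) + 1 : ℝ) ^ 2

theorem summable_inv_sq_shift (L : ℕ) : Summable fun i : ℕ => 1 / ((i + L : ℕ) + 1 : ℝ) ^ 2 := by
  have h := (summable_nat_add_iff (f := fun i : ℕ => 1 / (i : ℝ) ^ 2) (L + 1)).2
    (Real.summable_one_div_nat_pow.2 (le_refl 2))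
  refine h.congr fun i => ?_
  push_cast; ring

theorem tendsto_invSqTail : Tendsto invSqTail atTop (𝓝 0) :=
  tendsto_sum_nat_add (fun i : ℕ => 1 / ((i : ℝ) + 1) ^ 2)

theorem invSqTail_nonneg (L : ℕ) : 0 ≤ invSqTail L := tsum_nonneg fun i => by positivity

namespace DataSpace

variable {X : Type*} [MetricSpace X] [ConnectedSpace X] [ProperSpace X]
  [MeasurableSpace X] [BorelSpace X]

theorem measure_closedBall_le (Ξ : DataSpace X) (x : X) {r : ℝ} (hr : 0 < r) :
    Ξ.μ (Metric.closedBall x r) ≤ ENNReal.ofReal (Ξ.κ * r ^ Ξ.q) := by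
  obtain ⟨h1, h2⟩ := Ξ.ball_measure x r hr
  rwa [h1]

theorem measure_lt_top_of_isBounded (Ξ : DataSpace X) {s : Set X} (hs : Bornology.IsBounded s) :
    Ξ.μ s < ⊤ := by
  rcases s.eq_empty_or_nonempty with rfl | ⟨x, _⟩
  · simp
  obtain ⟨r, hr0, hr⟩ := hs.subset_closedBall_lt 0 x
  exact (measure_mono hr).trans_lt ((Ξ.measure_closedBall_le x hr0).trans_lt ENNReal.ofReal_lt_top)

/-- Either `n ≥ N`, or the space is compact and `K_{2n}` is the whole space. -/
def Large (Ξ : DataSpace X) (N n : ℝ) : Prop :=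
  N ≤ n ∨ (CompactSpace X ∧ Ξ.K (2 * n) = Set.univ)

theorem Large.mono {Ξ : DataSpace X} {N N' n : ℝ} (h : Ξ.Large N n) (hN : N' ≤ N) :
    Ξ.Large N' n :=
  h.imp hN.trans id

theorem Large.isCompact {Ξ : DataSpace X} {N n : ℝ} (h : Ξ.Large N n) (hN : 1 ≤ N) :
    IsCompact (Ξ.K (2 * n)) := by
  rcases h with h | ⟨h1, h2⟩
  · exact Ξ.K_compact _ (by linarith)
  · rw [h2]; exact isCompact_univ

theorem K_one_subset (Ξ : DataSpace X) {m : ℝ} (hm : 1 ≤ m) : Ξ.K 1 ⊆ Ξ.K m := by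
  rcases hm.eq_or_lt with rfl | h
  · exact subset_rfl
  · exact Ξ.K_mono _ _ le_rfl h

/-- A set of polynomially growing diameter lies in a ball of that radius, whose measure is bounded.
-/
theorem exists_measure_K_le (Ξ : DataSpace X) : ∃ C > 0, ∃ Q : ℝ, 0 < Q ∧ ∀ m : ℝ, 1 ≤ m →
    Ξ.μ (Ξ.K m) ≤ ENNReal.ofReal (C * m ^ Q) := by
  obtain ⟨c, hc, Q, hQ, h⟩ := Ξ.K_diam
  have hκ := Ξ.κ_pos
  have hq : 0 < Ξ.q := lt_of_lt_of_le one_pos Ξ.one_le_q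
  refine ⟨Ξ.κ * (c + 1) ^ Ξ.q, by positivity, Q * Ξ.q, by positivity, fun m hm => ?_⟩
  obtain ⟨x, hx⟩ : (Ξ.K m).Nonempty :=
    (nonempty_of_measure_ne_zero Ξ.K_one_pos.ne').mono (Ξ.K_one_subset hm)
  have hd := (le_abs_self _).trans (h m hm)
  have h1 : 1 ≤ m ^ Q := one_le_pow₀ hm
  have hsub : Ξ.K m ⊆ Metric.closedBall x ((c + 1) * m ^ Q) := fun y hy => by
    rw [Metric.mem_closedBall]
    have := Metric.dist_le_diam_of_mem (Ξ.K_compact m hm).isBounded hy hx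
    nlinarith
  refine (measure_mono hsub).trans ((Ξ.measure_closedBall_le x (by positivity)).trans_eq ?_)
  rw [Real.mul_rpow (by positivity) (by positivity), Real.rpow_mul (by linarith), Real.rpow_natCast]
  ring_nf

/-- Split into annuli of width `1 / m`. On the annulus with outer radius `a / m` the integrand is at
most `m ^ q / a ^ S` and the measure at most `κ (a / m) ^ q`, so the contribution is at most `κ / a
^ 2`. -/
theorem lintegral_decay_le (Ξ : DataSpace X) {S : ℕ} (hS : Ξ.q + 2 ≤ S) {m : ℝ} (hm : 0 < m)
    (L : ℕ) (y : X) :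
    ∫⁻ x in {x | L ≤ m * dist x y}, ENNReal.ofReal (m ^ Ξ.q * (1 / (1 + m * dist x y) ^ S)) ∂Ξ.μ ≤
      ENNReal.ofReal (Ξ.κ * invSqTail L) := by
  have hκ := Ξ.κ_pos
  set A : ℕ → Set X := fun i => {x | ((i + L : ℕ) : ℝ) ≤ m * dist x y ∧
    m * dist x y < (i + L : ℕ) + 1} with hA
  have hsub : {x | L ≤ m * dist x y} ⊆ ⋃ i, A i := fun x hx => by
    have hx : (L : ℝ) ≤ m * dist x y := hx
    have h0 : 0 ≤ m * dist x y := by positivity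
    have h1 : L ≤ ⌊m * dist x y⌋₊ := Nat.le_floor hx
    refine mem_iUnion.2 ⟨⌊m * dist x y⌋₊ - L, ?_⟩
    simp only [hA, mem_ofPred_eq, Nat.sub_add_cancel h1]
    exact ⟨Nat.floor_le h0, Nat.lt_floor_add_one _⟩
  refine (lintegral_mono_set hsub).trans ((lintegral_iUnion_le _ _).trans ?_)
  rw [invSqTail, ← tsum_mul_left, ENNReal.ofReal_tsum_of_nonneg (fun i => by positivity)
    ((summable_inv_sq_shift L).mul_left _)]
  refine ENNReal.tsum_le_tsum fun i => ?_
  set a : ℝ := ((i + L : ℕ) : ℝ) + 1 with ha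
  have ha1 : 1 ≤ a := by rw [ha]; linarith [(Nat.cast_nonneg (i + L) : (0 : ℝ) ≤ _)]
  have ha0 : 0 < a := by linarith
  have hAm : MeasurableSet (A i) := by
    have hc : Measurable fun x => m * dist x y := by fun_prop
    exact (measurableSet_le measurable_const hc).inter (measurableSet_lt hc measurable_const)
  calc ∫⁻ x in A i, ENNReal.ofReal (m ^ Ξ.q * (1 / (1 + m * dist x y) ^ S)) ∂Ξ.μ
      ≤ ∫⁻ x in A i, ENNReal.ofReal (m ^ Ξ.q * (1 / a ^ S)) ∂Ξ.μ := by
        refine setLIntegral_mono' hAm fun x hx => ENNReal.ofReal_le_ofReal ?_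
        gcongr
        rw [ha, add_comm]
        linarith [hx.1]
    _ = ENNReal.ofReal (m ^ Ξ.q * (1 / a ^ S)) * Ξ.μ (A i) := by
        rw [setLIntegral_const]
    _ ≤ ENNReal.ofReal (m ^ Ξ.q * (1 / a ^ S)) * ENNReal.ofReal (Ξ.κ * (a / m) ^ Ξ.q) := by
        gcongr
        refine (measure_mono ?_).trans (Ξ.measure_closedBall_le y (by positivity))
        intro x hx
        rw [Metric.mem_closedBall, le_div_iff₀ hm, mul_comm]
        exact hx.2.le
    _ ≤ _ := by
        rw [← ENNReal.ofReal_mul (by positivity)]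
        refine ENNReal.ofReal_le_ofReal ?_
        rw [Real.div_rpow ha0.le hm.le]
        have hmq : 0 < m ^ Ξ.q := by positivity
        have : a ^ Ξ.q * a ^ 2 ≤ a ^ S := by
          rw [← Real.rpow_natCast, ← Real.rpow_natCast, ← Real.rpow_add ha0]
          exact Real.rpow_le_rpow_of_exponent_le ha1 (by push_cast; linarith)
        have h2 : a ^ Ξ.q * (1 / a ^ S) ≤ 1 / a ^ 2 := by
          rw [mul_one_div, div_le_div_iff₀ (by positivity) (by positivity)]
          linarith
        calc m ^ Ξ.q * (1 / a ^ S) * (Ξ.κ * (a ^ Ξ.q / m ^ Ξ.q))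
            = Ξ.κ * (a ^ Ξ.q * (1 / a ^ S)) := by field_simp
          _ ≤ Ξ.κ * (1 / a ^ 2) := by gcongr

theorem lintegral_profile_le (Ξ : DataSpace X) {S : ℕ} (hS : Ξ.q + 2 ≤ S) {m : ℝ} (hm : 0 < m)
    (L : ℕ) (y : X) (A : Set X) :
    ∫⁻ x in A ∩ {x | L ≤ m * dist x y}, ENNReal.ofReal (Ξ.profile S m (dist x y)) ∂Ξ.μ ≤
      ENNReal.ofReal (Ξ.κ * invSqTail L) + ENNReal.ofReal (m ^ Ξ.q / m ^ S) * Ξ.μ A := by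
  have e : ∀ x, ENNReal.ofReal (Ξ.profile S m (dist x y)) =
      ENNReal.ofReal (m ^ Ξ.q * (1 / (1 + m * dist x y) ^ S)) +
        ENNReal.ofReal (m ^ Ξ.q / m ^ S) := fun x => by
    rw [← ENNReal.ofReal_add (by positivity) (by positivity), profile]
    ring_nf
  simp_rw [e]
  rw [lintegral_add_right _ measurable_const]
  refine add_le_add ((lintegral_mono_set inter_subset_right).trans
    (Ξ.lintegral_decay_le hS hm L y)) ?_
  rw [setLIntegral_const]
  gcongr
  exact inter_subset_left

/-- Fixes the localization order `S` once and for all, so that the constant term of the profile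
integrates to something small over `K_{2n}`. When `X` is compact, `n` may stay small while only `m`
is large; then finiteness of the total measure suffices. -/
theorem exists_measure_K_small (Ξ : DataSpace X) : ∃ S : ℕ, Ξ.q + 2 ≤ S ∧ ∀ ε : ℝ, 0 < ε →
    ∃ N : ℝ, 1 ≤ N ∧ ∀ n m : ℝ, N ≤ m → 2 * n ≤ m → Ξ.Large N n →
      ENNReal.ofReal (m ^ Ξ.q / m ^ S) * Ξ.μ (Ξ.K (2 * n)) ≤ ENNReal.ofReal ε := by
  obtain ⟨C, hC, Q, hQ, h⟩ := Ξ.exists_measure_K_le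
  have hq : 0 < Ξ.q := lt_of_lt_of_le one_pos Ξ.one_le_q
  obtain ⟨S, hS⟩ := exists_nat_ge (Ξ.q + Q + 2)
  have hbound : ∀ m : ℝ, 1 ≤ m → m ^ Ξ.q / m ^ S * m ^ Q ≤ 1 / m := fun m hm => by
    have hm0 : 0 < m := by linarith
    rw [div_mul_eq_mul_div, div_le_div_iff₀ (by positivity) hm0, ← Real.rpow_add hm0, one_mul,
      ← Real.rpow_natCast]
    calc m ^ (Ξ.q + Q) * m = m ^ (Ξ.q + Q + 1) := by rw [Real.rpow_add_one hm0.ne']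
      _ ≤ _ := Real.rpow_le_rpow_of_exponent_le hm (by linarith)
  refine ⟨S, by linarith, fun ε hε => ?_⟩
  by_cases hX : CompactSpace X
  · have hfin : Ξ.μ univ ≠ ⊤ := (Ξ.measure_lt_top_of_isBounded isCompact_univ.isBounded).ne
    set V := (Ξ.μ univ).toReal with hV
    have hV0 : 0 ≤ V := ENNReal.toReal_nonneg
    refine ⟨max 1 (V / ε), le_max_left _ _, fun n m hm _ _ => ?_⟩
    have hm1 : 1 ≤ m := (le_max_left _ _).trans hm
    have hm2 : V / ε ≤ m := (le_max_right _ _).trans hm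
    have hm0 : 0 < m := by linarith
    calc _ ≤ ENNReal.ofReal (m ^ Ξ.q / m ^ S) * ENNReal.ofReal V := by
          gcongr
          rw [hV, ENNReal.ofReal_toReal hfin]
          exact measure_mono (subset_univ _)
      _ = ENNReal.ofReal (m ^ Ξ.q / m ^ S * V) := by rw [ENNReal.ofReal_mul (by positivity)]
      _ ≤ _ := by
          refine ENNReal.ofReal_le_ofReal ?_
          have h1 : m ^ Ξ.q / m ^ S ≤ 1 / m := by
            refine le_trans ?_ (hbound m hm1)
            exact le_mul_of_one_le_right (by positivity) (Real.one_le_rpow hm1 hQ.le)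
          calc _ ≤ 1 / m * V := by gcongr
            _ ≤ ε := by
              rw [div_le_iff₀ hε] at hm2
              rw [one_div, inv_mul_le_iff₀ hm0]; linarith
  · refine ⟨max 1 (C / ε), le_max_left _ _, fun n m hm hnm hl => ?_⟩
    have hn : max 1 (C / ε) ≤ n := hl.resolve_right fun h => hX h.1
    have hn1 : 1 ≤ n := (le_max_left _ _).trans hn
    have hm1 : 1 ≤ m := (le_max_left _ _).trans hm
    have hm2 : C / ε ≤ m := (le_max_right _ _).trans hm
    have hm0 : 0 < m := by linarith
    calc _ ≤ ENNReal.ofReal (m ^ Ξ.q / m ^ S) * ENNReal.ofReal (C * m ^ Q) := by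
          gcongr
          refine (h _ (by linarith)).trans (ENNReal.ofReal_le_ofReal ?_)
          gcongr
      _ = ENNReal.ofReal (C * (m ^ Ξ.q / m ^ S * m ^ Q)) := by
          rw [← ENNReal.ofReal_mul (by positivity)]; ring_nf
      _ ≤ _ := by
          refine ENNReal.ofReal_le_ofReal ?_
          calc _ ≤ C * (1 / m) := by gcongr; exact hbound m hm1
            _ ≤ ε := by
              rw [div_le_iff₀ hε] at hm2
              rw [mul_one_div, div_le_iff₀ hm0]; linarith

/-- Cauchy–Schwarz in the reproducing formula with the sharp cutoff; the factor depending on `y` is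
bounded uniformly by `christoffel_le`. -/
theorem enorm_apply_le (Ξ : DataSpace X) {m : ℝ} (hm : 1 ≤ m) {P : C₀(X, ℝ)} (hP : P ∈ Ξ.poly m)
    (x : X) : ‖P x‖ₑ ≤ ENNReal.ofReal (√(∑ k ∈ Ξ.freqSet m, Ξ.phi k x ^ 2)) *
      (ENNReal.ofReal (√(Real.exp 1 * (Ξ.κ₁ * m ^ Ξ.q))) * ∫⁻ y, ‖P y‖ₑ ∂Ξ.μ) := by
  rw [← Ξ.integral_kernelOf_mul (b := fun _ => 1) le_rfl (fun _ _ => rfl) hP x,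
    ← lintegral_const_mul' _ _ ENNReal.ofReal_ne_top,
    ← lintegral_const_mul' _ _ ENNReal.ofReal_ne_top]
  refine (enorm_integral_le_lintegral_enorm _).trans (lintegral_mono fun y => ?_)
  rw [enorm_mul, ← mul_assoc]
  gcongr
  rw [Real.enorm_eq_ofReal_abs, ← ENNReal.ofReal_mul (by positivity)]
  refine ENNReal.ofReal_le_ofReal ?_
  have h1 : ∀ z : X, √(∑ k ∈ Ξ.freqSet m, |Ξ.phi k z| ^ 2) = √(∑ k ∈ Ξ.freqSet m, Ξ.phi k z ^ 2) :=
    fun z => by simp_rw [sq_abs]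
  calc |Ξ.kernelOf (fun _ => 1) m x y| ≤ ∑ k ∈ Ξ.freqSet m, |Ξ.phi k x| * |Ξ.phi k y| := by
        refine (Finset.abs_sum_le_sum_abs _ _).trans_eq ?_
        simp_rw [one_mul, abs_mul]
    _ ≤ √(∑ k ∈ Ξ.freqSet m, |Ξ.phi k x| ^ 2) * √(∑ k ∈ Ξ.freqSet m, |Ξ.phi k y| ^ 2) :=
        Real.sum_mul_le_sqrt_mul_sqrt _ _ _
    _ ≤ _ := by
        rw [h1, h1]
        gcongr
        exact Ξ.christoffel_le hm y

theorem integrable_sqrt_christoffel (Ξ : DataSpace X) (m : ℝ) :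
    Integrable (fun x => √(∑ k ∈ Ξ.freqSet m, Ξ.phi k x ^ 2)) Ξ.μ := by
  have h : Integrable (fun x => ∑ k ∈ Ξ.freqSet m, |Ξ.phi k x|) Ξ.μ :=
    integrable_finsetSum _ fun k _ => (Ξ.phi_integrable k).abs
  refine h.mono' ?_ (ae_of_all _ fun x => ?_)
  · refine Continuous.aestronglyMeasurable (Real.continuous_sqrt.comp ?_)
    refine continuous_finsetSum _ fun k _ => ?_
    have := (Ξ.phi k).continuous
    fun_prop
  · rw [Real.norm_of_nonneg (by positivity)]
    apply Real.sqrt_le_iff.2 ⟨by positivity, ?_⟩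
    have := Finset.sum_sq_le_sq_sum_of_nonneg (s := Ξ.freqSet m) (f := fun k => |Ξ.phi k x|)
      (fun k _ => abs_nonneg _)
    simpa only [sq_abs] using this

/-- Diffusion polynomials of order `n` have negligible `L¹` mass outside of `K_{2n}`. -/
theorem exists_lintegral_compl_K_le (Ξ : DataSpace X) {ε : ℝ} (hε : 0 < ε) :
    ∃ N : ℝ, 1 ≤ N ∧ ∀ n : ℝ, 0 < n → Ξ.Large N n → ∀ P ∈ Ξ.poly n,
      ∫⁻ x in (Ξ.K (2 * n))ᶜ, ‖P x‖ₑ ∂Ξ.μ ≤ ENNReal.ofReal ε * ∫⁻ x, ‖P x‖ₑ ∂Ξ.μ := by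
  have hκ := Ξ.κ₁_pos
  have hq : 0 < Ξ.q := lt_of_lt_of_le one_pos Ξ.one_le_q
  set c := √(Real.exp 1 * Ξ.κ₁) with hc
  have hc0 : 0 < c := by positivity
  -- The power `q / 2` compensates the growth of the square root of the Christoffel sum in
  -- `enorm_apply_le`.
  have hF := Ξ.K_integral (Ξ.q / 2) (by positivity)
  have hev := (hF.eventually_lt_const (show (0 : ℝ) < ε / c by positivity))
  obtain ⟨N, hN⟩ := eventually_atTop.1 hev
  refine ⟨max 1 N, le_max_left _ _, fun n hn hl P hP => ?_⟩
  rcases hl with hl | ⟨_, h2⟩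
  swap
  · simp [h2]
  have hn1 : 1 ≤ n := (le_max_left _ _).trans hl
  have hnN : N ≤ 2 * n := by linarith [(le_max_right 1 N).trans hl]
  set m := 2 * n with hm
  have hm1 : 1 ≤ m := by linarith
  have hm0 : 0 < m := by linarith
  have hlt := hN m hnN
  have e1 : ∀ x, (christoffelSum Ξ.lam (fun k x => Ξ.phi k x) m x) ^ (1 / 2 : ℝ) =
      √(∑ k ∈ Ξ.freqSet m, Ξ.phi k x ^ 2) := fun x => by
    rw [christoffelSum_eq, Real.sqrt_eq_rpow]
  simp_rw [e1] at hlt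
  have hP' : P ∈ Ξ.poly m := Ξ.poly_mono (by linarith) hP
  set I := ∫ x in (Ξ.K m)ᶜ, √(∑ k ∈ Ξ.freqSet m, Ξ.phi k x ^ 2) ∂Ξ.μ with hI
  have hI' : ∫⁻ x in (Ξ.K m)ᶜ, ENNReal.ofReal (√(∑ k ∈ Ξ.freqSet m, Ξ.phi k x ^ 2)) ∂Ξ.μ =
      ENNReal.ofReal I :=
    (ofReal_integral_eq_lintegral_ofReal (Ξ.integrable_sqrt_christoffel m).integrableOn
      (ae_of_all _ fun x => Real.sqrt_nonneg _)).symm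
  have hI0 : 0 ≤ I := integral_nonneg fun x => Real.sqrt_nonneg _
  have hfinP : ∫⁻ y, ‖P y‖ₑ ∂Ξ.μ ≠ ⊤ := (Ξ.integrable_of_mem_poly hP).2.ne
  calc _ ≤ ∫⁻ x in (Ξ.K m)ᶜ, ENNReal.ofReal (√(∑ k ∈ Ξ.freqSet m, Ξ.phi k x ^ 2)) *
      (ENNReal.ofReal (√(Real.exp 1 * (Ξ.κ₁ * m ^ Ξ.q))) * ∫⁻ y, ‖P y‖ₑ ∂Ξ.μ) ∂Ξ.μ :=
        lintegral_mono fun x => Ξ.enorm_apply_le hm1 hP' x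
    _ = ENNReal.ofReal I * (ENNReal.ofReal (√(Real.exp 1 * (Ξ.κ₁ * m ^ Ξ.q))) *
        ∫⁻ y, ‖P y‖ₑ ∂Ξ.μ) := by
        rw [lintegral_mul_const' _ _ (ENNReal.mul_ne_top ENNReal.ofReal_ne_top hfinP), hI']
    _ = ENNReal.ofReal (I * √(Real.exp 1 * (Ξ.κ₁ * m ^ Ξ.q))) * ∫⁻ y, ‖P y‖ₑ ∂Ξ.μ := by
        rw [ENNReal.ofReal_mul hI0, mul_assoc]
    _ ≤ _ := by
        gcongr
        rw [← mul_assoc, Real.sqrt_mul (by positivity), ← hc, Real.sqrt_eq_rpow (m ^ Ξ.q),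
          ← Real.rpow_mul hm0.le]
        have : Ξ.q * (1 / 2) = Ξ.q / 2 := by ring
        rw [this]
        rw [lt_div_iff₀ hc0] at hlt
        nlinarith

end DataSpace

/-! ### Oscillation of kernels and polynomials at scale `ε_n` -/

theorem exists_abs_freqCutoff_le : ∃ C : ℝ, 0 < C ∧ ∀ u, |freqCutoff u| ≤ C := by
  obtain ⟨C, hC0, hC⟩ := exists_gaussian_approx 0
  obtain ⟨a, _, h⟩ := hC 0
  refine ⟨C, hC0, fun u => ?_⟩
  have := h u
  simp only [Finset.range_zero, Finset.sum_empty, sub_zero, pow_zero, div_one] at this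
  refine this.trans (mul_le_of_le_one_right hC0.le (Real.exp_le_one_iff.2 ?_))
  nlinarith [sq_nonneg u]

namespace DataSpace

variable {X : Type*} [MetricSpace X] [ConnectedSpace X] [ProperSpace X]
  [MeasurableSpace X] [BorelSpace X]

/-- Handles bounded orders, including those below `1` where the Gaussian bound does not apply: only
finitely many `φ_k` occur. -/
theorem exists_abs_kernel_le_of_le (Ξ : DataSpace X) (m₀ : ℝ) : ∃ C : ℝ, 0 < C ∧
    ∀ m ≤ m₀, ∀ x y : X, |Ξ.kernel m x y| ≤ C := by
  obtain ⟨C, hC0, hC⟩ := exists_abs_freqCutoff_le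
  refine ⟨∑ k ∈ Ξ.freqSet m₀, C * (‖Ξ.phi k‖ * ‖Ξ.phi k‖) + 1, by positivity, fun m hm x y => ?_⟩
  have hsub : Ξ.freqSet m ⊆ Ξ.freqSet m₀ := fun k hk => by
    rw [mem_freqSet] at hk ⊢
    linarith
  calc _ ≤ ∑ k ∈ Ξ.freqSet m, C * (‖Ξ.phi k‖ * ‖Ξ.phi k‖) := by
        refine (Finset.abs_sum_le_sum_abs _ _).trans (Finset.sum_le_sum fun k _ => ?_)
        rw [abs_mul, abs_mul]
        gcongr
        · exact hC _
        · exact (Ξ.phi k).abs_apply_le_norm x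
        · exact (Ξ.phi k).abs_apply_le_norm y
    _ ≤ ∑ k ∈ Ξ.freqSet m₀, C * (‖Ξ.phi k‖ * ‖Ξ.phi k‖) :=
        Finset.sum_le_sum_of_subset_of_nonneg hsub fun _ _ _ => by positivity
    _ ≤ _ := by linarith

theorem abs_kernel_sub_le (Ξ : DataSpace X) {B : ℝ → ℝ} (hB : Ξ.BernsteinLipschitz B) {m : ℝ}
    (hm : 0 < m) {a C : ℝ} {x x' y : X} (hd : dist x x' ≤ a / B m) (hC : 0 ≤ C)
    (hk : ∀ x, |Ξ.kernel m x y| ≤ C) :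
    |Ξ.kernel m x y - Ξ.kernel m x' y| ≤ a * C := by
  obtain ⟨hB0, hBL⟩ := hB m hm
  obtain ⟨P, hP, hPe⟩ := Ξ.exists_poly_eq_kernelOf (fun k => freqCutoff (Ξ.lam k / m)) m y
  have hPe' : ∀ x, P x = Ξ.kernel m x y := hPe
  rw [← hPe', ← hPe']
  refine (hBL P hP x x').trans ?_
  have h1 : ‖P‖ ≤ C := P.norm_le_of_forall hC fun x => by rw [hPe']; exact hk x
  rw [le_div_iff₀ hB0] at hd
  have h2 : B m * dist x x' ≤ a := by linarith
  have h3 : 0 ≤ B m * dist x x' := by positivity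
  exact mul_le_mul h2 h1 (norm_nonneg _) (h3.trans h2)

theorem profile_le (Ξ : DataSpace X) (S : ℕ) {m r : ℝ} (hm : 1 ≤ m) (hr : 0 ≤ r) :
    Ξ.profile S m r ≤ 2 * m ^ Ξ.q := by
  have h1 : 1 / (1 + m * r) ^ S ≤ 1 := by
    rw [div_le_one (by positivity)]
    exact one_le_pow₀ (by nlinarith [mul_nonneg (by linarith : 0 ≤ m) hr])
  have h2 : 1 / m ^ S ≤ 1 := by
    rw [div_le_one (by positivity)]; exact one_le_pow₀ hm
  have h3 : 0 < m ^ Ξ.q := by positivity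
  rw [profile]
  nlinarith

theorem profile_le_of_dist (Ξ : DataSpace X) (S : ℕ) {m r r' : ℝ} (hm : 1 ≤ m) (hr : 0 ≤ r)
    (hr' : 0 ≤ r') (h : m * r ≤ m * r' + 1 / 2) :
    Ξ.profile S m r' ≤ 2 ^ S * Ξ.profile S m r := by
  have hm0 : 0 < m := by linarith
  have h1 : 1 / (1 + m * r') ^ S ≤ 2 ^ S * (1 / (1 + m * r) ^ S) := by
    rw [mul_one_div, div_le_div_iff₀ (by positivity) (by positivity), one_mul, ← mul_pow]
    gcongr
    nlinarith [mul_nonneg hm0.le hr']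
  have h2 : 1 / m ^ S ≤ 2 ^ S * (1 / m ^ S) :=
    le_mul_of_one_le_left (by positivity) (one_le_pow₀ (by norm_num))
  rw [profile, profile]
  calc _ ≤ m ^ Ξ.q * (2 ^ S * (1 / (1 + m * r) ^ S) + 2 ^ S * (1 / m ^ S)) := by gcongr
    _ = _ := by ring

theorem continuous_kernel (Ξ : DataSpace X) (m : ℝ) :
    Continuous fun p : X × X => Ξ.kernel m p.1 p.2 := Ξ.continuous_kernelOf _ m

theorem measurable_profile (Ξ : DataSpace X) (S : ℕ) (m : ℝ) : Measurable (Ξ.profile S m) := by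
  unfold profile
  fun_prop

/-- Where `m ρ ≥ L`, both kernel values are bounded by the profile, whose integral is small for
large `L`. Where `m ρ < L`, the Bernstein–Lipschitz condition bounds the difference by a multiple of
`a m ^ q` on a ball of measure of order `(L / m) ^ q`. Hence `L` is chosen first, and then `a`
depending on it. -/
theorem exists_kernel_oscillation_large (Ξ : DataSpace X) {ε : ℝ} (hε : 0 < ε) :
    ∃ a : ℝ, 0 < a ∧ ∃ N : ℝ, 1 ≤ N ∧ ∀ B : ℝ → ℝ, Ξ.BernsteinLipschitz B → ∀ n : ℝ, N ≤ n →
      ∀ s : ℝ, s ≤ a * min (1 / n) (1 / B (2 * n)) → ∃ H : X → X → ℝ≥0∞,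
        Measurable (Function.uncurry H) ∧
        (∀ x x' y, dist x x' ≤ s → ‖Ξ.kernel (2 * n) x y - Ξ.kernel (2 * n) x' y‖ₑ ≤ H x y) ∧
        ∀ y, ∫⁻ x in Ξ.K (2 * n), H x y ∂Ξ.μ ≤ ENNReal.ofReal ε := by
  obtain ⟨S, hS, hK⟩ := Ξ.exists_measure_K_small
  obtain ⟨C, hC0, hC⟩ := Ξ.abs_kernel_le S
  have hκ := Ξ.κ_pos
  have hq : 0 < Ξ.q := lt_of_lt_of_le one_pos Ξ.one_le_q
  set D := C * (1 + 2 ^ S) with hD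
  have hD0 : 0 < D := by positivity
  obtain ⟨N, hN1, hN⟩ := hK (ε / (4 * D)) (by positivity)
  obtain ⟨L, hL⟩ : ∃ L : ℕ, Ξ.κ * invSqTail L < ε / (4 * D) := by
    have := (tendsto_invSqTail.const_mul Ξ.κ).eventually_lt_const
      (show Ξ.κ * 0 < ε / (4 * D) by rw [mul_zero]; positivity)
    exact this.exists
  set E := 2 * C * Ξ.κ * ((L : ℝ) + 1) ^ Ξ.q with hE
  have hE0 : 0 < E := by positivity
  -- The bound `1 / 4` gives `m s ≤ 1 / 2`, so that the profiles at `x` and `x'` are comparable; the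
  -- other bound makes the near-diagonal integral at most `ε / 2`.
  set a := min (1 / 4) (ε / (2 * E)) with ha
  have ha0 : 0 < a := by positivity
  have haE : a * E ≤ ε / 2 := by
    have : a ≤ ε / (2 * E) := min_le_right _ _
    rw [le_div_iff₀ (by positivity)] at this
    linarith
  refine ⟨a, ha0, N, hN1, fun B hB n hn s hs => ?_⟩
  have hn1 : 1 ≤ n := hN1.trans hn
  set m := 2 * n with hm
  have hm1 : 1 ≤ m := by linarith
  have hm0 : 0 < m := by linarith
  have hB0 : 0 < B m := (hB m hm0).1
  have hsB : s ≤ a / B m := by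
    refine hs.trans ?_
    rw [div_eq_mul_one_div a]
    gcongr
    exact min_le_right _ _
  have hsn : m * s ≤ 1 / 2 := by
    have h1 : s ≤ 1 / 4 * (1 / n) := by
      refine hs.trans ?_
      gcongr
      · exact min_le_left _ _
      · exact min_le_left _ _
    calc m * s ≤ m * (1 / 4 * (1 / n)) := by gcongr
      _ = 1 / 2 := by rw [hm]; field_simp; norm_num
  refine ⟨fun x y => if (L : ℝ) ≤ m * dist x y then ENNReal.ofReal (D * Ξ.profile S m (dist x y))
    else ENNReal.ofReal (a * (2 * C * m ^ Ξ.q)), ?_, ?_, ?_⟩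
  · have hd : Measurable fun p : X × X => dist p.1 p.2 := continuous_dist.measurable
    refine Measurable.ite (measurableSet_le measurable_const (hd.const_mul m)) ?_ measurable_const
    exact (((Ξ.measurable_profile S m).comp hd).const_mul D).ennreal_ofReal
  · intro x x' y hxx
    have hms : m * dist x x' ≤ 1 / 2 := le_trans (by gcongr) hsn
    rw [Real.enorm_eq_ofReal_abs]
    beta_reduce
    split_ifs with h
    · refine ENNReal.ofReal_le_ofReal ?_
      have h1 : Ξ.profile S m (dist x' y) ≤ 2 ^ S * Ξ.profile S m (dist x y) :=
        Ξ.profile_le_of_dist S hm1 dist_nonneg dist_nonneg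
          (by nlinarith [dist_triangle x x' y])
      calc _ ≤ |Ξ.kernel m x y| + |Ξ.kernel m x' y| := abs_sub _ _
        _ ≤ C * Ξ.profile S m (dist x y) + C * (2 ^ S * Ξ.profile S m (dist x y)) :=
          add_le_add (hC m hm1 x y) ((hC m hm1 x' y).trans (by gcongr))
        _ = _ := by rw [hD]; ring
    · refine ENNReal.ofReal_le_ofReal ?_
      refine Ξ.abs_kernel_sub_le hB hm0 (hxx.trans hsB) (by positivity) fun z => ?_
      refine (hC m hm1 z y).trans ?_
      calc _ ≤ C * (2 * m ^ Ξ.q) := by gcongr; exact Ξ.profile_le S hm1 dist_nonneg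
        _ = _ := by ring
  · intro y
    have hms : MeasurableSet {x : X | (L : ℝ) ≤ m * dist x y} :=
      measurableSet_le measurable_const (by fun_prop)
    rw [← lintegral_inter_add_sdiff _ _ hms]
    have b1 : ∫⁻ x in Ξ.K m ∩ {x : X | (L : ℝ) ≤ m * dist x y},
        (if (L : ℝ) ≤ m * dist x y then ENNReal.ofReal (D * Ξ.profile S m (dist x y))
          else ENNReal.ofReal (a * (2 * C * m ^ Ξ.q))) ∂Ξ.μ ≤ ENNReal.ofReal (ε / 2) := by
      calc _ ≤ ∫⁻ x in Ξ.K m ∩ {x : X | (L : ℝ) ≤ m * dist x y},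
            ENNReal.ofReal D * ENNReal.ofReal (Ξ.profile S m (dist x y)) ∂Ξ.μ := by
            refine setLIntegral_mono' ((Ξ.K_compact m hm1).measurableSet.inter hms) fun x hx => ?_
            rw [if_pos (show (L : ℝ) ≤ m * dist x y from hx.2), ENNReal.ofReal_mul hD0.le]
        _ ≤ ENNReal.ofReal D * (ENNReal.ofReal (Ξ.κ * invSqTail L) +
            ENNReal.ofReal (m ^ Ξ.q / m ^ S) * Ξ.μ (Ξ.K m)) := by
            rw [lintegral_const_mul' _ _ ENNReal.ofReal_ne_top]
            gcongr
            exact Ξ.lintegral_profile_le hS hm0 L y _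
        _ ≤ ENNReal.ofReal D * (ENNReal.ofReal (ε / (4 * D)) + ENNReal.ofReal (ε / (4 * D))) := by
            gcongr
            exact hN n m (by linarith) le_rfl (Or.inl hn)
        _ = ENNReal.ofReal (ε / 2) := by
            rw [← ENNReal.ofReal_add (by positivity) (by positivity),
              ← ENNReal.ofReal_mul hD0.le]
            congr 1; field_simp; norm_num
    have b2 : ∫⁻ x in Ξ.K m \ {x : X | (L : ℝ) ≤ m * dist x y},
        (if (L : ℝ) ≤ m * dist x y then ENNReal.ofReal (D * Ξ.profile S m (dist x y))
          else ENNReal.ofReal (a * (2 * C * m ^ Ξ.q))) ∂Ξ.μ ≤ ENNReal.ofReal (ε / 2) := by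
      calc _ ≤ ∫⁻ x in Ξ.K m \ {x : X | (L : ℝ) ≤ m * dist x y},
            ENNReal.ofReal (a * (2 * C * m ^ Ξ.q)) ∂Ξ.μ := by
            refine setLIntegral_mono' ((Ξ.K_compact m hm1).measurableSet.diff hms) fun x hx => ?_
            rw [if_neg (show ¬ (L : ℝ) ≤ m * dist x y from hx.2)]
        _ ≤ ENNReal.ofReal (a * (2 * C * m ^ Ξ.q)) *
            ENNReal.ofReal (Ξ.κ * (((L : ℝ) + 1) / m) ^ Ξ.q) := by
            rw [setLIntegral_const]
            gcongr
            refine (measure_mono ?_).trans (Ξ.measure_closedBall_le y (by positivity))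
            intro x hx
            have : m * dist x y < L := not_le.1 hx.2
            rw [Metric.mem_closedBall, le_div_iff₀ hm0]
            linarith
        _ ≤ _ := by
            rw [← ENNReal.ofReal_mul (by positivity)]
            refine ENNReal.ofReal_le_ofReal ?_
            refine le_of_eq_of_le ?_ haE
            rw [Real.div_rpow (by positivity) hm0.le, hE]
            field_simp
    refine (add_le_add b1 b2).trans_eq ?_
    rw [← ENNReal.ofReal_add (by positivity) (by positivity)]
    ring_nf

theorem exists_kernel_oscillation_compact (Ξ : DataSpace X) [CompactSpace X] (N : ℝ) {ε : ℝ}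
    (hε : 0 < ε) :
    ∃ a : ℝ, 0 < a ∧ ∀ B : ℝ → ℝ, Ξ.BernsteinLipschitz B → ∀ n : ℝ, 0 < n → n ≤ N →
      ∀ s : ℝ, s ≤ a * min (1 / n) (1 / B (2 * n)) → ∃ H : X → X → ℝ≥0∞,
        Measurable (Function.uncurry H) ∧
        (∀ x x' y, dist x x' ≤ s → ‖Ξ.kernel (2 * n) x y - Ξ.kernel (2 * n) x' y‖ₑ ≤ H x y) ∧
        ∀ y, ∫⁻ x in Ξ.K (2 * n), H x y ∂Ξ.μ ≤ ENNReal.ofReal ε := by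
  obtain ⟨C, hC0, hC⟩ := Ξ.exists_abs_kernel_le_of_le (2 * N)
  have hfin : Ξ.μ univ ≠ ⊤ := (Ξ.measure_lt_top_of_isBounded isCompact_univ.isBounded).ne
  set V := (Ξ.μ univ).toReal with hV
  have hV0 : 0 ≤ V := ENNReal.toReal_nonneg
  refine ⟨ε / (C * (V + 1)), by positivity, fun B hB n hn0 hn s hs =>
    ⟨fun _ _ => ENNReal.ofReal (ε / (C * (V + 1)) * C), measurable_const, ?_, fun y => ?_⟩⟩
  · intro x x' y hxx
    rw [Real.enorm_eq_ofReal_abs]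
    refine ENNReal.ofReal_le_ofReal (Ξ.abs_kernel_sub_le hB (by linarith) (hxx.trans ?_) hC0.le
      fun z => hC _ (by linarith) z y)
    refine hs.trans ?_
    have hB0 := (hB (2 * n) (by linarith)).1
    rw [div_eq_mul_one_div (ε / (C * (V + 1)))]
    exact mul_le_mul_of_nonneg_left (min_le_right _ _) (by positivity)
  · rw [setLIntegral_const]
    calc _ ≤ ENNReal.ofReal (ε / (C * (V + 1)) * C) * ENNReal.ofReal V := by
          gcongr
          rw [hV, ENNReal.ofReal_toReal hfin]
          exact measure_mono (subset_univ _)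
      _ ≤ _ := by
          rw [← ENNReal.ofReal_mul (by positivity)]
          refine ENNReal.ofReal_le_ofReal ?_
          have : ε / (C * (V + 1)) * C * V = ε * (V / (V + 1)) := by field_simp
          rw [this]
          refine mul_le_of_le_one_right hε.le ?_
          rw [div_le_one (by positivity)]; linarith

/-- The oscillation of diffusion polynomials at scale `a ε_n` is small in `L¹(K_{2n})`. -/
theorem exists_oscillation_le (Ξ : DataSpace X) {ε : ℝ} (hε : 0 < ε) :
    ∃ a : ℝ, 0 < a ∧ ∃ N : ℝ, 1 ≤ N ∧ ∀ B : ℝ → ℝ, Ξ.BernsteinLipschitz B → ∀ n : ℝ, 0 < n →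
      Ξ.Large N n → ∀ s : ℝ, s ≤ a * min (1 / n) (1 / B (2 * n)) → ∀ P ∈ Ξ.poly n,
        ∃ O : X → ℝ≥0∞, Measurable O ∧ (∀ x x', dist x x' ≤ s → ‖P x - P x'‖ₑ ≤ O x) ∧
          ∫⁻ x in Ξ.K (2 * n), O x ∂Ξ.μ ≤ ENNReal.ofReal ε * ∫⁻ x, ‖P x‖ₑ ∂Ξ.μ := by
  have hsf := Ξ.sigmaFinite
  have main : ∃ a : ℝ, 0 < a ∧ ∃ N : ℝ, 1 ≤ N ∧ ∀ B : ℝ → ℝ, Ξ.BernsteinLipschitz B →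
      ∀ n : ℝ, 0 < n → Ξ.Large N n → ∀ s : ℝ, s ≤ a * min (1 / n) (1 / B (2 * n)) →
      ∃ H : X → X → ℝ≥0∞, Measurable (Function.uncurry H) ∧
        (∀ x x' y, dist x x' ≤ s → ‖Ξ.kernel (2 * n) x y - Ξ.kernel (2 * n) x' y‖ₑ ≤ H x y) ∧
        ∀ y, ∫⁻ x in Ξ.K (2 * n), H x y ∂Ξ.μ ≤ ENNReal.ofReal ε := by
    obtain ⟨a, ha, N, hN, h⟩ := Ξ.exists_kernel_oscillation_large hε
    by_cases hX : CompactSpace X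
    · obtain ⟨a', ha', h'⟩ := Ξ.exists_kernel_oscillation_compact N hε
      refine ⟨min a a', lt_min ha ha', N, hN, fun B hB n hn hl s hs => ?_⟩
      have hB0 : 0 < B (2 * n) := (hB _ (by linarith)).1
      have hmin : 0 < min (1 / n) (1 / B (2 * n)) := by positivity
      rcases le_total N n with hNn | hNn
      · exact h B hB n hNn s (hs.trans (by gcongr; exact min_le_left _ _))
      · exact h' B hB n hn hNn s (hs.trans (by gcongr; exact min_le_right _ _))
    · exact ⟨a, ha, N, hN, fun B hB n _ hl s hs => h B hB n (hl.resolve_right fun h => hX h.1) s hs⟩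
  obtain ⟨a, ha, N, hN, h⟩ := main
  refine ⟨a, ha, N, hN, fun B hB n hn hl s hs P hP => ?_⟩
  obtain ⟨H, hHm, hH, hHi⟩ := h B hB n hn hl s hs
  have hPm : Measurable fun y => ‖P y‖ₑ := P.continuous.measurable.enorm
  have hfm : Measurable (Function.uncurry fun x y => H x y * ‖P y‖ₑ) :=
    hHm.mul (hPm.comp measurable_snd)
  -- The difference of two values of `P` is the integral of `P` against the difference of kernels;
  -- Tonelli then reduces the claim to the bound on `∫ H x y dx`, uniform in `y`.
  refine ⟨fun x => ∫⁻ y, H x y * ‖P y‖ₑ ∂Ξ.μ, hfm.lintegral_prod_right', fun x x' hxx => ?_, ?_⟩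
  · have hint : ∀ z, Integrable (fun y => Ξ.kernel (2 * n) z y * P y) Ξ.μ := fun z => by
      obtain ⟨Q, -, hQ⟩ := Ξ.exists_poly_eq_kernelOf (fun k => freqCutoff (Ξ.lam k / (2 * n)))
        (2 * n) z
      refine (Ξ.integrable_mul_of_mem_poly hP Q).congr (ae_of_all _ fun y => ?_)
      simp only [hQ, kernel, Ξ.kernelOf_comm _ _ y z]
    rw [← Ξ.integral_kernel_mul (by linarith) le_rfl hP x,
      ← Ξ.integral_kernel_mul (by linarith : 0 < 2 * n) le_rfl hP x',
      ← integral_sub (hint x) (hint x')]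
    refine (enorm_integral_le_lintegral_enorm _).trans (lintegral_mono fun y => ?_)
    rw [← sub_mul, enorm_mul]
    gcongr
    exact hH x x' y hxx
  · rw [lintegral_lintegral_swap hfm.aemeasurable]
    calc _ ≤ ∫⁻ y, ENNReal.ofReal ε * ‖P y‖ₑ ∂Ξ.μ := by
          refine lintegral_mono fun y => ?_
          rw [lintegral_mul_const' _ _ enorm_ne_top]
          gcongr
          exact hHi y
      _ = _ := by rw [lintegral_const_mul' _ _ ENNReal.ofReal_ne_top]

/-! ### Mass of polynomials where balls have small measure -/

/-- Diffusion polynomials have negligible `L¹` mass on the part of `K_{2n}` where balls of radius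
`L / m` have small measure. -/
theorem exists_lintegral_thin_le (Ξ : DataSpace X) {ε : ℝ} (hε : 0 < ε) :
    ∃ L : ℕ, 1 ≤ L ∧ ∃ η : ℝ, 0 < η ∧ ∃ N : ℝ, 1 ≤ N ∧ ∀ n m : ℝ, 0 < n → 2 * n ≤ m → N ≤ m →
      Ξ.Large N n → ∀ P ∈ Ξ.poly n, ∀ O : X → ℝ≥0∞, Measurable O →
        (∀ x x', dist x x' ≤ L / m → ‖P x - P x'‖ₑ ≤ O x) →
        ∫⁻ x in {x ∈ Ξ.K (2 * n) | Ξ.μ (Metric.closedBall x (L / m) ∩ Ξ.K (2 * n)) ≤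
            ENNReal.ofReal (η * m ^ (-Ξ.q))}, ‖P x‖ₑ ∂Ξ.μ ≤
          ∫⁻ x in Ξ.K (2 * n), O x ∂Ξ.μ + ENNReal.ofReal ε * ∫⁻ x, ‖P x‖ₑ ∂Ξ.μ := by
  have hsf := Ξ.sigmaFinite
  obtain ⟨S, hS, hK⟩ := Ξ.exists_measure_K_small
  obtain ⟨C, hC0, hC⟩ := Ξ.abs_kernel_le S
  have hκ := Ξ.κ_pos
  have hq : 0 < Ξ.q := lt_of_lt_of_le one_pos Ξ.one_le_q
  obtain ⟨N₁, hN₁, hK₁⟩ := hK (ε / (8 * C)) (by positivity)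
  obtain ⟨N₂, hN₂, hK₂⟩ := hK 1 one_pos
  set D := C * (Ξ.κ * invSqTail 0 + 1) with hD
  have hD0 : 0 < D := by have := invSqTail_nonneg 0; positivity
  obtain ⟨N₃, hN₃, hT⟩ := Ξ.exists_lintegral_compl_K_le (show 0 < ε / (4 * D) by positivity)
  obtain ⟨L, hL1, hL⟩ : ∃ L : ℕ, 1 ≤ L ∧ Ξ.κ * invSqTail L < ε / (8 * C) := by
    have := (tendsto_invSqTail.const_mul Ξ.κ).eventually_lt_const
      (show Ξ.κ * 0 < ε / (8 * C) by rw [mul_zero]; positivity)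
    exact ((eventually_ge_atTop 1).and this).exists
  refine ⟨L, hL1, 1 / (4 * C), by positivity, max N₁ (max N₂ N₃), hN₁.trans (le_max_left _ _), ?_⟩
  intro n m hn hnm hNm hl P hP O hOm hO
  have hl₁ := hl.mono (le_max_left N₁ (max N₂ N₃))
  have hl₂ := hl.mono ((le_max_left N₂ N₃).trans (le_max_right N₁ (max N₂ N₃)))
  have hl₃ := hl.mono ((le_max_right N₂ N₃).trans (le_max_right N₁ (max N₂ N₃)))
  have hm₁ : N₁ ≤ m := (le_max_left _ _).trans hNm
  have hm₂ : N₂ ≤ m := ((le_max_left N₂ N₃).trans (le_max_right _ _)).trans hNm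
  have hm1 : 1 ≤ m := hN₁.trans hm₁
  have hm0 : 0 < m := by linarith
  have hKm : MeasurableSet (Ξ.K (2 * n)) := (hl₁.isCompact hN₁).measurableSet
  set K := Ξ.K (2 * n) with hKdef
  -- For `(x, y)` in `A` the bound on the measure near `x` applies. The complement is either far
  -- from the diagonal or has `y` outside `K_{2n}`; both contribute little after integrating over
  -- `x`.
  set A : Set (X × X) := {p | p.2 ∈ K ∧ m * dist p.1 p.2 < L} with hA
  have hAm : MeasurableSet A :=
    (hKm.preimage measurable_snd).inter
      (measurableSet_lt (continuous_dist.measurable.const_mul m) measurable_const)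
  set f : X × X → ℝ≥0∞ := fun p => ‖Ξ.kernel m p.1 p.2‖ₑ * ‖P p.2‖ₑ with hf
  have hfm : Measurable f := ((Ξ.continuous_kernel m).measurable.enorm).mul
    (P.continuous.measurable.enorm.comp measurable_snd)
  set R : X → ℝ≥0∞ := fun x => ∫⁻ y, Aᶜ.indicator f (x, y) ∂Ξ.μ with hR
  have hRm : Measurable (Function.uncurry fun x y => Aᶜ.indicator f (x, y)) :=
    hfm.indicator hAm.compl
  have hkb : ∀ x y, ‖Ξ.kernel m x y‖ₑ ≤
      ENNReal.ofReal C * ENNReal.ofReal (Ξ.profile S m (dist x y)) := fun x y => by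
    rw [Real.enorm_eq_ofReal_abs, ← ENNReal.ofReal_mul hC0.le]
    exact ENNReal.ofReal_le_ofReal (hC m hm1 x y)
  have hpt : ∀ x ∈ {x ∈ K | Ξ.μ (Metric.closedBall x (L / m) ∩ K) ≤
      ENNReal.ofReal (1 / (4 * C) * m ^ (-Ξ.q))}, ‖P x‖ₑ ≤ O x + 2 * R x := by
    rintro x ⟨_, hx⟩
    have hAx : MeasurableSet {y | (x, y) ∈ A} := hAm.preimage (by fun_prop)
    have h1 : ‖P x‖ₑ ≤ ∫⁻ y, f (x, y) ∂Ξ.μ := by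
      conv_lhs => rw [← Ξ.integral_kernel_mul hm0 hnm hP x]
      refine (enorm_integral_le_lintegral_enorm _).trans_eq ?_
      simp only [hf, enorm_mul]
    rw [← lintegral_add_compl _ hAx] at h1
    have h2 : ∫⁻ y in {y | (x, y) ∈ A}ᶜ, f (x, y) ∂Ξ.μ = R x := by
      rw [hR, ← lintegral_indicator hAx.compl]
      rfl
    -- Near a thin point the kernel is at most `2 C m ^ q` on a set of measure at most `m ^ (-q) /
    -- (4 C)`, and `|P y| ≤ |P x| + O x`. The resulting factor `1 / 2` lets the term `|P x|` be
    -- absorbed on the left.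
    have h3 : ∫⁻ y in {y | (x, y) ∈ A}, f (x, y) ∂Ξ.μ ≤ 2⁻¹ * (‖P x‖ₑ + O x) := by
      calc _ ≤ ∫⁻ y in {y | (x, y) ∈ A}, ENNReal.ofReal (C * (2 * m ^ Ξ.q)) *
            (‖P x‖ₑ + O x) ∂Ξ.μ := by
            refine setLIntegral_mono' hAx fun y hy => ?_
            have hy2 : m * dist x y < L := hy.2
            refine mul_le_mul' ?_ ?_
            · rw [Real.enorm_eq_ofReal_abs]
              refine ENNReal.ofReal_le_ofReal ((hC m hm1 x y).trans ?_)
              gcongr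
              exact Ξ.profile_le S hm1 dist_nonneg
            · have : dist x y ≤ L / m := by rw [le_div_iff₀ hm0]; linarith
              calc ‖P y‖ₑ = ‖P x - (P x - P y)‖ₑ := by rw [sub_sub_cancel]
                _ ≤ ‖P x‖ₑ + ‖P x - P y‖ₑ := enorm_sub_le
                _ ≤ _ := by gcongr; exact hO x y this
        _ ≤ ENNReal.ofReal (C * (2 * m ^ Ξ.q)) * (‖P x‖ₑ + O x) *
            ENNReal.ofReal (1 / (4 * C) * m ^ (-Ξ.q)) := by
            rw [setLIntegral_const]
            gcongr
            refine (measure_mono ?_).trans hx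
            intro y hy
            refine ⟨?_, hy.1⟩
            rw [Metric.mem_closedBall, dist_comm, le_div_iff₀ hm0]
            have hy2 : m * dist x y < L := hy.2
            linarith
        _ = _ := by
            rw [mul_right_comm, ← ENNReal.ofReal_mul (by positivity)]
            congr 1
            rw [Real.rpow_neg hm0.le]
            have : C * (2 * m ^ Ξ.q) * (1 / (4 * C) * (m ^ Ξ.q)⁻¹) = 2⁻¹ := by
              field_simp; norm_num
            rw [this, ENNReal.ofReal_inv_of_pos two_pos]
            simp
    rw [h2] at h1
    have h4 : ‖P x‖ₑ ≤ 2⁻¹ * (‖P x‖ₑ + O x) + R x := h1.trans (by gcongr)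
    have h5 : 2 * ‖P x‖ₑ ≤ ‖P x‖ₑ + (O x + 2 * R x) := by
      calc 2 * ‖P x‖ₑ ≤ 2 * (2⁻¹ * (‖P x‖ₑ + O x) + R x) := by gcongr
        _ = _ := by
          rw [mul_add, ← mul_assoc, ENNReal.mul_inv_cancel (by simp) (by simp), one_mul, add_assoc]
    rw [two_mul] at h5
    exact (ENNReal.add_le_add_iff_left enorm_ne_top).1 h5
  have hRi : ∫⁻ x in K, R x ∂Ξ.μ ≤ ENNReal.ofReal (ε / 2) * ∫⁻ x, ‖P x‖ₑ ∂Ξ.μ := by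
    rw [hR, lintegral_lintegral_swap hRm.aemeasurable, ← lintegral_add_compl _ hKm]
    have b1 : ∫⁻ y in K, ∫⁻ x in K, Aᶜ.indicator f (x, y) ∂Ξ.μ ∂Ξ.μ ≤
        ENNReal.ofReal (ε / 4) * ∫⁻ x, ‖P x‖ₑ ∂Ξ.μ := by
      rw [← lintegral_const_mul' _ _ ENNReal.ofReal_ne_top]
      refine le_trans ?_ (setLIntegral_le_lintegral K _)
      refine setLIntegral_mono' hKm fun y hy => ?_
      have hms : MeasurableSet {x : X | (L : ℝ) ≤ m * dist x y} :=
        measurableSet_le measurable_const (by fun_prop)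
      calc ∫⁻ x in K, Aᶜ.indicator f (x, y) ∂Ξ.μ
          ≤ ∫⁻ x in K, {x : X | (L : ℝ) ≤ m * dist x y}.indicator (fun x =>
            ENNReal.ofReal C * ENNReal.ofReal (Ξ.profile S m (dist x y)) * ‖P y‖ₑ) x ∂Ξ.μ := by
            refine lintegral_mono fun x => ?_
            by_cases hx : (L : ℝ) ≤ m * dist x y
            · rw [indicator_of_mem (show x ∈ {x : X | (L : ℝ) ≤ m * dist x y} from hx)]
              refine (indicator_le_self _ _ _).trans ?_
              simp only [hf]
              gcongr
              exact hkb x y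
            · rw [indicator_of_notMem]
              · exact zero_le
              · exact fun h => h ⟨hy, not_le.1 hx⟩
        _ = ENNReal.ofReal C * (∫⁻ x in K ∩ {x : X | (L : ℝ) ≤ m * dist x y},
            ENNReal.ofReal (Ξ.profile S m (dist x y)) ∂Ξ.μ) * ‖P y‖ₑ := by
            rw [lintegral_indicator hms, Measure.restrict_restrict hms, inter_comm,
              lintegral_mul_const' _ _ enorm_ne_top, lintegral_const_mul' _ _ ENNReal.ofReal_ne_top]
        _ ≤ ENNReal.ofReal C * (ENNReal.ofReal (ε / (8 * C)) + ENNReal.ofReal (ε / (8 * C))) *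
            ‖P y‖ₑ := by
            gcongr
            refine (Ξ.lintegral_profile_le hS hm0 L y _).trans ?_
            gcongr
            exact hK₁ n m hm₁ hnm hl₁
        _ = _ := by
            rw [← ENNReal.ofReal_add (by positivity) (by positivity), ← ENNReal.ofReal_mul hC0.le]
            congr 2; field_simp; norm_num
    -- Here only boundedness of `∫ |kernel| dx` is used; smallness comes from the mass of `P`
    -- outside `K_{2n}`.
    have b2 : ∫⁻ y in Kᶜ, ∫⁻ x in K, Aᶜ.indicator f (x, y) ∂Ξ.μ ∂Ξ.μ ≤
        ENNReal.ofReal (ε / 4) * ∫⁻ x, ‖P x‖ₑ ∂Ξ.μ := by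
      calc _ ≤ ∫⁻ y in Kᶜ, ENNReal.ofReal D * ‖P y‖ₑ ∂Ξ.μ := by
            refine lintegral_mono fun y => ?_
            calc _ ≤ ∫⁻ x in K, ENNReal.ofReal C *
                  ENNReal.ofReal (Ξ.profile S m (dist x y)) * ‖P y‖ₑ ∂Ξ.μ := by
                  refine lintegral_mono fun x => (indicator_le_self _ _ _).trans ?_
                  simp only [hf]
                  gcongr
                  exact hkb x y
              _ = ENNReal.ofReal C * (∫⁻ x in K, ENNReal.ofReal (Ξ.profile S m (dist x y)) ∂Ξ.μ) *
                  ‖P y‖ₑ := by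
                  rw [lintegral_mul_const' _ _ enorm_ne_top,
                    lintegral_const_mul' _ _ ENNReal.ofReal_ne_top]
              _ ≤ ENNReal.ofReal C * (ENNReal.ofReal (Ξ.κ * invSqTail 0) + ENNReal.ofReal 1) *
                  ‖P y‖ₑ := by
                  gcongr
                  have h0 := Ξ.lintegral_profile_le hS hm0 0 y K
                  have hu : {x : X | ((0 : ℕ) : ℝ) ≤ m * dist x y} = univ :=
                    eq_univ_of_forall fun x => by
                      change ((0 : ℕ) : ℝ) ≤ m * dist x y
                      simp only [Nat.cast_zero]; positivity
                  rw [hu, inter_univ] at h0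
                  refine h0.trans ?_
                  gcongr
                  exact hK₂ n m hm₂ hnm hl₂
              _ = _ := by
                  have := invSqTail_nonneg 0
                  rw [← ENNReal.ofReal_add (by positivity) (by positivity),
                    ← ENNReal.ofReal_mul hC0.le]
        _ ≤ ENNReal.ofReal D * (ENNReal.ofReal (ε / (4 * D)) * ∫⁻ x, ‖P x‖ₑ ∂Ξ.μ) := by
            rw [lintegral_const_mul' _ _ ENNReal.ofReal_ne_top]
            gcongr
            exact hT n hn hl₃ P hP
        _ = _ := by
            rw [← mul_assoc, ← ENNReal.ofReal_mul hD0.le]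
            congr 2; field_simp
    refine (add_le_add b1 b2).trans_eq ?_
    rw [← add_mul, ← ENNReal.ofReal_add (by positivity) (by positivity)]
    ring_nf
  calc _ ≤ ∫⁻ x in {x ∈ K | Ξ.μ (Metric.closedBall x (L / m) ∩ K) ≤
        ENNReal.ofReal (1 / (4 * C) * m ^ (-Ξ.q))}, (O x + 2 * R x) ∂Ξ.μ :=
        setLIntegral_mono (hOm.add (hRm.lintegral_prod_right'.const_mul 2)) hpt
    _ ≤ ∫⁻ x in K, (O x + 2 * R x) ∂Ξ.μ := lintegral_mono_set (sep_subset _ _)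
    _ = ∫⁻ x in K, O x ∂Ξ.μ + 2 * ∫⁻ x in K, R x ∂Ξ.μ := by
        rw [lintegral_add_left hOm, lintegral_const_mul' _ _ (by simp)]
    _ ≤ ∫⁻ x in K, O x ∂Ξ.μ + 2 * (ENNReal.ofReal (ε / 2) * ∫⁻ x, ‖P x‖ₑ ∂Ξ.μ) := by gcongr
    _ = _ := by
        rw [← mul_assoc]
        congr 2
        have : (2 : ℝ≥0∞) = ENNReal.ofReal 2 := by simp
        rw [this, ← ENNReal.ofReal_mul two_pos.le]
        ring_nf

end DataSpace

/-! ### Duality for quadrature weights -/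

/-- A linear functional dominated by a weighted sum of absolute values of finitely many linear
functionals is a linear combination of them with dominated coefficients, by the Hahn–Banach
theorem. -/
theorem exists_weights_of_abs_le {V ι : Type*} [AddCommGroup V] [Module ℝ V] [Fintype ι]
    (ev : V →ₗ[ℝ] (ι → ℝ)) (I : V →ₗ[ℝ] ℝ) {a : ι → ℝ} (ha : ∀ k, 0 ≤ a k)
    (hle : ∀ P, |I P| ≤ ∑ k, a k * |ev P k|) :
    ∃ w : ι → ℝ, (∀ k, |w k| ≤ a k) ∧ ∀ P, I P = ∑ k, w k * ev P k := by
  classical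
  let N : (ι → ℝ) → ℝ := fun v => ∑ k, a k * |v k|
  -- The domination forces `I` to vanish on the kernel of `ev`, so it factors through `ev`. The
  -- factor is then extended from the range of `ev` under the weighted `ℓ¹` seminorm `N`.
  obtain ⟨ℓ, hℓ⟩ : ∃ ℓ : Module.Dual ℝ (ι → ℝ), ev.dualMap ℓ = I := by
    have h0 : I ∈ (LinearMap.ker ev).dualAnnihilator := by
      rw [Submodule.mem_dualAnnihilator]
      intro P hP
      have h1 := hle P
      rw [LinearMap.mem_ker.1 hP] at h1
      simpa using h1
    rwa [← LinearMap.range_dualMap_eq_dualAnnihilator_ker] at h0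
  have hℓ' : ∀ P, ℓ (ev P) = I P := fun P => by rw [← hℓ]; rfl
  obtain ⟨g, hg, hgN⟩ := exists_extension_of_le_sublinear
    ⟨LinearMap.range ev, ℓ.domRestrict _⟩ N
    (fun b hb v => by
      simp only [N, Pi.smul_apply, smul_eq_mul, abs_mul, abs_of_pos hb, Finset.mul_sum]
      exact Finset.sum_congr rfl fun k _ => by ring)
    (fun u v => by
      simp only [N, ← Finset.sum_add_distrib, ← mul_add]
      refine Finset.sum_le_sum fun k _ => ?_
      have := ha k
      gcongr
      exact abs_add_le _ _)
    (by
      rintro ⟨_, P, rfl⟩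
      refine le_trans (le_of_eq ?_) ((le_abs_self _).trans (hle P))
      exact hℓ' P)
  have hgN' : ∀ v, |g v| ≤ N v := fun v => by
    refine abs_le.2 ⟨?_, hgN v⟩
    have := hgN (-v)
    simp only [map_neg, N, Pi.neg_apply, abs_neg] at this
    simp only [N]; linarith
  -- The seminorm of the `k`-th coordinate vector is `a k`, which bounds the `k`-th weight.
  refine ⟨fun k => g (Pi.single k 1), fun k => ?_, fun P => ?_⟩
  · refine (hgN' _).trans_eq ?_
    simp only [N]
    rw [Finset.sum_eq_single k]
    · simp
    · intro j _ hj; simp [hj]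
    · simp
  · have h1 : g (ev P) = I P := by
      rw [← hℓ' P]
      exact hg ⟨ev P, ⟨P, rfl⟩⟩
    rw [← h1, LinearMap.pi_apply_eq_sum_univ g]
    refine Finset.sum_congr rfl fun k _ => ?_
    have hk : (fun j => if k = j then (1 : ℝ) else 0) = Pi.single k 1 := by
      ext j; simp [Pi.single_apply, eq_comm]
    rw [smul_eq_mul, mul_comm, hk]

/-! ### Nearest-point cells and Marcinkiewicz–Zygmund weights -/

namespace DataSpace

variable {X : Type*} [MetricSpace X] [ConnectedSpace X] [ProperSpace X]
  [MeasurableSpace X] [BorelSpace X]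

/-- The ball condition is for positive radii; the case `r = 0`, needed when the mesh norm vanishes,
follows by letting the radius decrease. -/
theorem measureReal_closedBall_le (Ξ : DataSpace X) (x : X) {r : ℝ} (hr : 0 ≤ r) :
    Ξ.μ.real (Metric.closedBall x r) ≤ Ξ.κ * r ^ Ξ.q := by
  have hq : 0 < Ξ.q := lt_of_lt_of_le one_pos Ξ.one_le_q
  have hκ := Ξ.κ_pos
  have h1 : ∀ᶠ t in 𝓝[>] r, Ξ.μ.real (Metric.closedBall x r) ≤ Ξ.κ * t ^ Ξ.q := by
    filter_upwards [self_mem_nhdsWithin] with t ht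
    have ht' : r < t := ht
    have ht0 : 0 < t := hr.trans_lt ht'
    refine ENNReal.toReal_le_of_le_ofReal (by positivity) ?_
    exact (measure_mono (Metric.closedBall_subset_closedBall ht'.le)).trans
      (Ξ.measure_closedBall_le x ht0)
  have h2 : Tendsto (fun t : ℝ => Ξ.κ * t ^ Ξ.q) (𝓝[>] r) (𝓝 (Ξ.κ * r ^ Ξ.q)) :=
    ((Real.continuous_rpow_const hq.le).tendsto r).const_mul _ |>.mono_left nhdsWithin_le_nhds
  exact ge_of_tendsto h2 h1

theorem infDist_le_mesh (Ξ : DataSpace X) {n : ℝ} (hK : IsCompact (Ξ.K (2 * n))) {M : ℕ}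
    (z : Fin M → X) {x : X} (hx : x ∈ Ξ.K (2 * n)) : Metric.infDist x (range z) ≤ Ξ.mesh n z := by
  have hb : BddAbove (range fun x : ↥(Ξ.K (2 * n)) => Metric.infDist (x : X) (range z)) := by
    have := hK.bddAbove_image (f := fun x => Metric.infDist x (range z))
      (Metric.continuous_infDist_pt _).continuousOn
    rwa [image_eq_range] at this
  exact le_ciSup hb ⟨x, hx⟩

theorem mesh_nonneg (Ξ : DataSpace X) (n : ℝ) {M : ℕ} (z : Fin M → X) : 0 ≤ Ξ.mesh n z :=
  Real.iSup_nonneg fun _ => Metric.infDist_nonneg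

/-- The points of `K_{2n}` at distance at most `s` from `z`, with nearest point `z_k`; ties are
resolved by taking the least index. -/
def cell (Ξ : DataSpace X) (n s : ℝ) {M : ℕ} (z : Fin M → X) (k : Fin M) : Set X :=
  {x | x ∈ Ξ.K (2 * n) ∧ dist x (z k) ≤ s ∧ (∀ j, dist x (z k) ≤ dist x (z j)) ∧
    ∀ j, j < k → dist x (z k) < dist x (z j)}

theorem measurableSet_cell (Ξ : DataSpace X) {n : ℝ} (hK : IsCompact (Ξ.K (2 * n))) (s : ℝ) {M : ℕ}
    (z : Fin M → X) (k : Fin M) : MeasurableSet (Ξ.cell n s z k) := by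
  have hd : ∀ j, Measurable fun x => dist x (z j) := fun j => by fun_prop
  have e : Ξ.cell n s z k = Ξ.K (2 * n) ∩ ({x | dist x (z k) ≤ s} ∩
      ((⋂ j, {x | dist x (z k) ≤ dist x (z j)}) ∩
        ⋂ j, ⋂ _ : j < k, {x | dist x (z k) < dist x (z j)})) := by
    ext x; simp only [cell, mem_inter_iff, mem_iInter, mem_ofPred_eq]
  rw [e]
  exact hK.measurableSet.inter ((measurableSet_le (hd k) measurable_const).inter
    ((MeasurableSet.iInter fun j => measurableSet_le (hd k) (hd j)).inter
      (MeasurableSet.iInter fun j => MeasurableSet.iInter fun _ => measurableSet_lt (hd k) (hd j))))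

theorem pairwise_disjoint_cell (Ξ : DataSpace X) (n s : ℝ) {M : ℕ} (z : Fin M → X) :
    Pairwise (Function.onFun Disjoint (Ξ.cell n s z)) := by
  intro j k hjk
  refine Set.disjoint_left.2 fun x hj hk => ?_
  rcases lt_or_gt_of_ne hjk with h | h
  · exact (hk.2.2.2 j h).not_ge (hj.2.2.1 k)
  · exact (hj.2.2.2 k h).not_ge (hk.2.2.1 j)

theorem mem_iUnion_cell (Ξ : DataSpace X) {n s : ℝ} {M : ℕ} (z : Fin M → X) {x : X}
    (hx : x ∈ Ξ.K (2 * n)) {k₀ : Fin M} (hk : dist x (z k₀) ≤ s) : x ∈ ⋃ k, Ξ.cell n s z k := by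
  -- A lexicographic minimum of distance and index implements the tie-breaking rule of the cells.
  obtain ⟨k, -, hmin⟩ := Finset.exists_min_image Finset.univ
    (fun j : Fin M => toLex (dist x (z j), j)) ⟨k₀, Finset.mem_univ _⟩
  have hmin' : ∀ j, dist x (z k) < dist x (z j) ∨ dist x (z k) = dist x (z j) ∧ k ≤ j :=
    fun j => by simpa [Prod.Lex.toLex_le_toLex] using hmin j (Finset.mem_univ _)
  have hle : ∀ j, dist x (z k) ≤ dist x (z j) := fun j =>
    (hmin' j).elim le_of_lt fun h => h.1.le
  refine mem_iUnion.2 ⟨k, hx, (hle k₀).trans hk, hle, fun j hj => ?_⟩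
  exact (hmin' j).resolve_right fun h => h.2.not_gt hj

/-- A point of a cell is as close to its node as to any node. The radius is thus the mesh norm
whatever the truncation `s`, so the size bounds on the weights need no smallness of the mesh norm.
-/
theorem cell_subset_closedBall (Ξ : DataSpace X) {n : ℝ} (hK : IsCompact (Ξ.K (2 * n))) (s : ℝ)
    {M : ℕ} (z : Fin M → X) (k : Fin M) :
    Ξ.cell n s z k ⊆ Metric.closedBall (z k) (Ξ.mesh n z) := by
  intro x hx
  rw [Metric.mem_closedBall]
  refine le_trans ?_ (Ξ.infDist_le_mesh hK z hx.1)
  refine (Metric.le_infDist ⟨z k, mem_range_self k⟩).2 ?_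
  rintro _ ⟨j, rfl⟩
  exact hx.2.2.1 j

/-- The measures of the cells satisfy the Marcinkiewicz–Zygmund inequality if the cells cover
`K_{2n}` up to a set that carries little mass of diffusion polynomials. -/
theorem isMZ_cell (Ξ : DataSpace X) {n s ε₁ ε₂ ε₃ : ℝ} (h₁ : 0 ≤ ε₁) (h₂ : 0 ≤ ε₂) (h₃ : 0 ≤ ε₃)
    (hK : IsCompact (Ξ.K (2 * n))) {M : ℕ} (z : Fin M → X)
    (hosc : ∀ P ∈ Ξ.poly n, ∃ O : X → ℝ≥0∞, Measurable O ∧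
      (∀ x x', dist x x' ≤ s → ‖P x - P x'‖ₑ ≤ O x) ∧
        ∫⁻ x in Ξ.K (2 * n), O x ∂Ξ.μ ≤ ENNReal.ofReal ε₁ * ∫⁻ x, ‖P x‖ₑ ∂Ξ.μ)
    (htail : ∀ P ∈ Ξ.poly n,
      ∫⁻ x in (Ξ.K (2 * n))ᶜ, ‖P x‖ₑ ∂Ξ.μ ≤ ENNReal.ofReal ε₂ * ∫⁻ x, ‖P x‖ₑ ∂Ξ.μ)
    (hcov : ∀ P ∈ Ξ.poly n, ∫⁻ x in {x ∈ Ξ.K (2 * n) | ∀ k, s < dist x (z k)}, ‖P x‖ₑ ∂Ξ.μ ≤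
      ENNReal.ofReal ε₃ * ∫⁻ x, ‖P x‖ₑ ∂Ξ.μ) :
    Ξ.IsMZ n (max Ξ.κ 1) (ε₁ + ε₂ + ε₃) z fun k => Ξ.μ.real (Ξ.cell n s z k) := by
  have hsf := Ξ.sigmaFinite
  have hKfin : Ξ.μ (Ξ.K (2 * n)) < ⊤ := Ξ.measure_lt_top_of_isBounded hK.isBounded
  have hsub : ∀ k, Ξ.cell n s z k ⊆ Ξ.K (2 * n) := fun k x hx => hx.1
  have hcfin : ∀ k, Ξ.μ (Ξ.cell n s z k) ≠ ⊤ := fun k => ((measure_mono (hsub k)).trans_lt hKfin).ne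
  have hm := Ξ.measurableSet_cell hK s z
  have hdisj := Ξ.pairwise_disjoint_cell n s z
  have hmesh := Ξ.mesh_nonneg n z
  set Y := ⋃ k, Ξ.cell n s z k with hY
  have hYm : MeasurableSet Y := MeasurableSet.iUnion hm
  have hYK : Y ⊆ Ξ.K (2 * n) := iUnion_subset hsub
  refine ⟨fun k => measureReal_nonneg, fun k => ?_, ?_, fun P hP => ?_⟩
  · calc _ ≤ Ξ.μ.real (Metric.closedBall (z k) (Ξ.mesh n z)) :=
          measureReal_mono (Ξ.cell_subset_closedBall hK s z k)
            (Ξ.measure_lt_top_of_isBounded Metric.isBounded_closedBall).ne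
      _ ≤ Ξ.κ * Ξ.mesh n z ^ Ξ.q := Ξ.measureReal_closedBall_le _ hmesh
      _ ≤ _ := by gcongr; exact le_max_left _ _
  · have hfin : Ξ.μ (Metric.cthickening (4 * Ξ.mesh n z) (Ξ.K (2 * n))) ≠ ⊤ :=
      (Ξ.measure_lt_top_of_isBounded hK.isBounded.cthickening).ne
    calc ∑ k, Ξ.μ.real (Ξ.cell n s z k) = Ξ.μ.real Y := by
          rw [hY, measureReal_iUnion_fintype hdisj hm hcfin]
      _ ≤ Ξ.nbhdMeasure n (4 * Ξ.mesh n z) :=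
          measureReal_mono (hYK.trans (Metric.self_subset_cthickening _)) hfin
      _ ≤ _ := le_mul_of_one_le_left measureReal_nonneg (le_max_right _ _)
  · obtain ⟨O, hOm, hO, hOi⟩ := hosc P hP
    have hPi := Ξ.integrable_of_mem_poly hP
    have hPa : Integrable (fun x => |P x|) Ξ.μ := hPi.abs
    have hI : ∫ x, |P x| ∂Ξ.μ = (∫⁻ x, ‖P x‖ₑ ∂Ξ.μ).toReal :=
      integral_norm_eq_lintegral_enorm hPi.1
    have hIfin : ∫⁻ x, ‖P x‖ₑ ∂Ξ.μ ≠ ⊤ := hPi.2.ne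
    -- The error consists of the oscillation on each cell and the mass off all cells. The latter
    -- lies outside `K_{2n}` or at points farther than `s` from every node.
    have hsplit : ∑ k, Ξ.μ.real (Ξ.cell n s z k) * |P (z k)| - ∫ x, |P x| ∂Ξ.μ =
        ∑ k, (∫ x in Ξ.cell n s z k, (|P (z k)| - |P x|) ∂Ξ.μ) - ∫ x in Yᶜ, |P x| ∂Ξ.μ := by
      rw [← integral_add_compl hYm hPa, hY, integral_iUnion_fintype hm hdisj
        (fun k => hPa.integrableOn), ← sub_sub, ← Finset.sum_sub_distrib]
      congr 1
      refine Finset.sum_congr rfl fun k _ => ?_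
      have hc : IntegrableOn (fun _ => |P (z k)|) (Ξ.cell n s z k) Ξ.μ := integrableOn_const (hcfin k)
      rw [integral_sub hc hPa.integrableOn, setIntegral_const,
        smul_eq_mul]
    have hE : ‖∑ k, Ξ.μ.real (Ξ.cell n s z k) * |P (z k)| - ∫ x, |P x| ∂Ξ.μ‖ₑ ≤
        ENNReal.ofReal (ε₁ + ε₂ + ε₃) * ∫⁻ x, ‖P x‖ₑ ∂Ξ.μ := by
      rw [hsplit]
      have a1 : ‖∑ k, (∫ x in Ξ.cell n s z k, (|P (z k)| - |P x|) ∂Ξ.μ)‖ₑ ≤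
          ENNReal.ofReal ε₁ * ∫⁻ x, ‖P x‖ₑ ∂Ξ.μ := by
        calc _ ≤ ∑ k, ∫⁻ x in Ξ.cell n s z k, O x ∂Ξ.μ := by
              refine (enorm_sum_le _ _).trans (Finset.sum_le_sum fun k _ => ?_)
              refine (enorm_integral_le_lintegral_enorm _).trans
                (setLIntegral_mono' (hm k) fun x hx => ?_)
              refine le_trans ?_ (hO x (z k) hx.2.1)
              rw [Real.enorm_eq_ofReal_abs, Real.enorm_eq_ofReal_abs, abs_sub_comm (P x)]
              exact ENNReal.ofReal_le_ofReal (abs_abs_sub_abs_le _ _)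
          _ = ∫⁻ x in Y, O x ∂Ξ.μ := by
              rw [hY, lintegral_iUnion hm hdisj, tsum_fintype]
          _ ≤ ∫⁻ x in Ξ.K (2 * n), O x ∂Ξ.μ := lintegral_mono_set hYK
          _ ≤ _ := hOi
      have a2 : ‖∫ x in Yᶜ, |P x| ∂Ξ.μ‖ₑ ≤ ENNReal.ofReal ε₂ * ∫⁻ x, ‖P x‖ₑ ∂Ξ.μ +
          ENNReal.ofReal ε₃ * ∫⁻ x, ‖P x‖ₑ ∂Ξ.μ := by
        have hYc : Yᶜ ⊆ (Ξ.K (2 * n))ᶜ ∪ {x ∈ Ξ.K (2 * n) | ∀ k, s < dist x (z k)} := by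
          intro x hx
          by_cases hxK : x ∈ Ξ.K (2 * n)
          · refine Or.inr ⟨hxK, fun k => ?_⟩
            by_contra hk
            exact hx (Ξ.mem_iUnion_cell z hxK (not_lt.1 hk))
          · exact Or.inl hxK
        calc _ ≤ ∫⁻ x in Yᶜ, ‖P x‖ₑ ∂Ξ.μ := by
              refine (enorm_integral_le_lintegral_enorm _).trans (lintegral_mono fun x => ?_)
              simp
          _ ≤ _ := (lintegral_mono_set hYc).trans ((lintegral_union_le _ _ _).trans
              (add_le_add (htail P hP) (hcov P hP)))
      refine (enorm_sub_le.trans (add_le_add a1 a2)).trans_eq ?_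
      rw [ENNReal.ofReal_add (by positivity) h₃, ENNReal.ofReal_add h₁ h₂]
      ring
    rw [Real.enorm_eq_ofReal_abs, ← ENNReal.ofReal_toReal hIfin,
      ← ENNReal.ofReal_mul (by positivity)] at hE
    rw [hI] at hE ⊢
    exact (ENNReal.ofReal_le_ofReal_iff (by positivity)).1 hE

theorem IsMZ.mono {Ξ : DataSpace X} {n c ε ε' : ℝ} {M : ℕ} {z : Fin M → X} {W : Fin M → ℝ}
    (h : Ξ.IsMZ n c ε z W) (hε : ε ≤ ε') : Ξ.IsMZ n c ε' z W :=
  ⟨h.1, h.2.1, h.2.2.1, fun P hP => (h.2.2.2 P hP).trans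
    (mul_le_mul_of_nonneg_right hε (integral_nonneg fun _ => abs_nonneg _))⟩

/-- Marcinkiewicz–Zygmund weights with relative error `1 / 2` dominate the weights of an exact
quadrature formula. -/
theorem IsMZ.exists_isQuadrature {Ξ : DataSpace X} {n c : ℝ} {M : ℕ} {z : Fin M → X}
    {W : Fin M → ℝ} (h : Ξ.IsMZ n c (1 / 2) z W) : ∃ w, Ξ.IsQuadrature n (2 * c) z W w := by
  obtain ⟨hW0, -, hWs, hMZ⟩ := h
  let ev : Ξ.poly n →ₗ[ℝ] (Fin M → ℝ) :=
    { toFun := fun P k => (P : C₀(X, ℝ)) (z k)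
      map_add' := fun P Q => by ext k; simp
      map_smul' := fun a P => by ext k; simp }
  let I : Ξ.poly n →ₗ[ℝ] ℝ :=
    { toFun := fun P => ∫ x, (P : C₀(X, ℝ)) x ∂Ξ.μ
      map_add' := fun P Q => by
        simpa using integral_add (Ξ.integrable_of_mem_poly P.2) (Ξ.integrable_of_mem_poly Q.2)
      map_smul' := fun a P => by simp [integral_const_mul] }
  -- Relative error `1 / 2` gives `∑ W k * |P (z k)| ≥ (1 / 2) ∫ |P|`.
  have hle : ∀ P : Ξ.poly n, |I P| ≤ ∑ k, 2 * W k * |ev P k| := fun P => by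
    have h1 := hMZ P P.2
    have h2 : |I P| ≤ ∫ x, |(P : C₀(X, ℝ)) x| ∂Ξ.μ := abs_integral_le_integral_abs
    have h3 : ∑ k, 2 * W k * |ev P k| = 2 * ∑ k, W k * |(P : C₀(X, ℝ)) (z k)| := by
      rw [Finset.mul_sum]
      exact Finset.sum_congr rfl fun k _ => mul_assoc _ _ _
    rw [abs_le] at h1
    rw [h3]
    linarith [h1.1]
  obtain ⟨w, hw, hwI⟩ := exists_weights_of_abs_le (V := Ξ.poly n) (a := fun k => 2 * W k) ev I
    (fun k => mul_nonneg two_pos.le (hW0 k)) hle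
  refine ⟨w, hw, ?_, fun P hP => (hwI ⟨P, hP⟩).symm⟩
  calc _ ≤ ∑ k, 2 * W k := Finset.sum_le_sum fun k _ => hw k
    _ = 2 * ∑ k, W k := by rw [Finset.mul_sum]
    _ ≤ _ := by rw [mul_assoc]; gcongr

end DataSpace

/-! ### Covering by independent samples -/

section Sampling

variable {X : Type*} [MetricSpace X] [MeasurableSpace X] [BorelSpace X]

/-- A maximal separated family of points where balls have measure more than `θ` in `K`. -/
theorem exists_separated_net (μ : Measure X) {K : Set X} (hK : MeasurableSet K) (hfin : μ K ≠ ⊤)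
    (R : ℝ) {θ : ℝ} (hθ : 0 < θ) : ∃ t : Finset X,
      (∀ x ∈ t, θ < μ.real (Metric.closedBall x R ∩ K)) ∧ t.card * θ ≤ μ.real K ∧
      ∀ x, θ < μ.real (Metric.closedBall x R ∩ K) → ∃ y ∈ t, dist x y ≤ 2 * R := by
  classical
  set G : Set X := {x | θ < μ.real (Metric.closedBall x R ∩ K)} with hG
  let V : Finset X → Prop := fun t => (∀ x ∈ t, x ∈ G) ∧
    (t : Set X).Pairwise fun x y => 2 * R < dist x y
  have hcard : ∀ t, V t → t.card * θ ≤ μ.real K := fun t ht => by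
    calc t.card * θ = ∑ x ∈ t, θ := by rw [Finset.sum_const, nsmul_eq_mul]
      _ ≤ ∑ x ∈ t, μ.real (Metric.closedBall x R ∩ K) :=
          Finset.sum_le_sum fun x hx => le_of_lt (ht.1 x hx)
      _ = μ.real (⋃ x ∈ t, Metric.closedBall x R ∩ K) := by
          rw [measureReal_biUnion_finset]
          · intro x hx y hy hxy
            refine Set.disjoint_left.2 fun u hu hv => ?_
            have h1 := ht.2 hx hy hxy
            have h2 := Metric.mem_closedBall'.1 hu.1
            have h3 := Metric.mem_closedBall.1 hv.1
            linarith [dist_triangle x u y]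
          · exact fun x _ => Metric.isClosed_closedBall.measurableSet.inter hK
      _ ≤ μ.real K := measureReal_mono (iUnion₂_subset fun x _ => inter_subset_right) hfin
  -- The balls around separated points are disjoint in `K`, so cardinalities are bounded and a
  -- family of maximal cardinality exists; maximality makes it a net.
  set T : Set ℕ := {c | ∃ t, V t ∧ t.card = c} with hT
  have hTne : T.Nonempty := ⟨0, ∅, ⟨by simp, by simp⟩, rfl⟩
  have hTb : BddAbove T := by
    refine ⟨⌊μ.real K / θ⌋₊, ?_⟩
    rintro _ ⟨t, ht, rfl⟩
    refine Nat.le_floor ?_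
    rw [le_div_iff₀ hθ]
    exact hcard t ht
  obtain ⟨t, ht, htc⟩ := Nat.sSup_mem hTne hTb
  refine ⟨t, ht.1, hcard t ht, fun x hx => ?_⟩
  by_contra! hcon
  have hxt : x ∉ t := fun hxt => by
    have h := hcon x hxt
    rw [dist_self] at h
    have : Metric.closedBall x R = ∅ := Metric.closedBall_eq_empty.2 (by linarith)
    rw [this] at hx
    simp at hx
    linarith
  have hV : V (insert x t) := by
    refine ⟨fun y hy => ?_, ?_⟩
    · rcases Finset.mem_insert.1 hy with rfl | hy
      · exact hx
      · exact ht.1 y hy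
    · rw [Finset.coe_insert]
      refine ht.2.insert fun y hy _ => ⟨hcon y hy, ?_⟩
      rw [dist_comm]
      exact hcon y hy
  have := le_csSup hTb ⟨insert x t, hV, rfl⟩
  rw [Finset.card_insert_of_notMem hxt, htc] at this
  omega

/-- With `M` independent samples from `K`, the probability that some point with a ball of
substantial measure is far from all the samples is exponentially small. -/
theorem measure_pi_cond_uncovered_le (μ : Measure X) {K : Set X} (hK : MeasurableSet K)
    (hfin : μ K ≠ ⊤) (hpos : μ K ≠ 0) (R : ℝ) {θ : ℝ} (hθ : 0 < θ) (M : ℕ) :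
    Measure.pi (fun _ : Fin M => ProbabilityTheory.cond μ K)
      {z | ∃ x, θ < μ.real (Metric.closedBall x R ∩ K) ∧ ∀ k, 3 * R < dist x (z k)} ≤
      ENNReal.ofReal (μ.real K / θ * Real.exp (-(θ / μ.real K * M))) := by
  have hprob : IsProbabilityMeasure (ProbabilityTheory.cond μ K) :=
    ProbabilityTheory.cond_isProbabilityMeasure_of_finite hpos hfin
  obtain ⟨t, ht, hcard, hnet⟩ := exists_separated_net μ hK hfin R hθ
  have hKpos : 0 < μ.real K := ENNReal.toReal_pos hpos hfin
  set p := θ / μ.real K with hp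
  have hone : ∀ x ∈ t, (ProbabilityTheory.cond μ K) (Metric.closedBall x R)ᶜ ≤
      ENNReal.ofReal (Real.exp (-p)) := fun x hx => by
    have hBm : MeasurableSet (Metric.closedBall x R) := Metric.isClosed_closedBall.measurableSet
    rw [← ofReal_measureReal, probReal_compl_eq_one_sub hBm]
    refine ENNReal.ofReal_le_ofReal ?_
    have h1 : p ≤ (ProbabilityTheory.cond μ K).real (Metric.closedBall x R) := by
      rw [measureReal_def, ProbabilityTheory.cond_apply hK, ENNReal.toReal_mul, ENNReal.toReal_inv,
        inter_comm, hp, div_eq_inv_mul]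
      have := (ht x hx).le
      have h0 : 0 ≤ (μ K).toReal⁻¹ := by positivity
      exact mul_le_mul_of_nonneg_left this h0
    have := Real.add_one_le_exp (-p)
    linarith
  -- If a sample point lies within `R` of the net point `y` and `x` is within `2 R` of `y`, then `x`
  -- is within `3 R` of the sample. So an uncovered `x` forces every sample to miss the ball around
  -- `y`.
  have hsub : {z : Fin M → X | ∃ x, θ < μ.real (Metric.closedBall x R ∩ K) ∧
      ∀ k, 3 * R < dist x (z k)} ⊆
      ⋃ y ∈ t, Set.pi univ fun _ : Fin M => (Metric.closedBall y R)ᶜ := by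
    rintro z ⟨x, hx, hz⟩
    obtain ⟨y, hy, hxy⟩ := hnet x hx
    refine mem_iUnion₂.2 ⟨y, hy, fun k _ hk => ?_⟩
    have h1 := hz k
    have h2 := Metric.mem_closedBall'.1 hk
    linarith [dist_triangle x y (z k)]
  calc _ ≤ ∑ y ∈ t, Measure.pi (fun _ : Fin M => ProbabilityTheory.cond μ K)
        (Set.pi univ fun _ : Fin M => (Metric.closedBall y R)ᶜ) :=
        (measure_mono hsub).trans (measure_biUnion_finset_le _ _)
    _ ≤ ∑ y ∈ t, ENNReal.ofReal (Real.exp (-(p * M))) := by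
        refine Finset.sum_le_sum fun y hy => ?_
        rw [Measure.pi_pi, Finset.prod_const, Finset.card_univ, Fintype.card_fin]
        calc _ ≤ ENNReal.ofReal (Real.exp (-p)) ^ M := by gcongr; exact hone y hy
          _ = _ := by
            rw [← ENNReal.ofReal_pow (Real.exp_pos _).le, ← Real.exp_nat_mul]
            congr 2; ring
    _ = ENNReal.ofReal (t.card * Real.exp (-(p * M))) := by
        rw [Finset.sum_const, nsmul_eq_mul, ENNReal.ofReal_mul (by positivity),
          ENNReal.ofReal_natCast]
    _ ≤ _ := by
        refine ENNReal.ofReal_le_ofReal ?_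
        gcongr
        rwa [le_div_iff₀ hθ]

end Sampling

/-- Part of the sample size cancels the net cardinality, which is at most `δ T / θ`. Since `T ≥ 2`
gives `log T ≥ 1 / 2`, the other part contributes `exp (-(1 / θ + 1))`, which absorbs `1 / θ`. -/
theorem net_mul_exp_lt {k V E θ δ M : ℝ} (hk : 0 < k) (hV : k ≤ V) (hE : 0 < E) (hθ : 0 < θ)
    (hδ : 0 < δ) (hT : 2 ≤ V / (δ * E))
    (hM : (1 + 2 * (1 / θ + 1)) / θ * E⁻¹ * k * Real.log (V / (δ * E)) ≤ M) :
    k / (θ * E) * Real.exp (-(θ * E / k * M)) < δ := by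
  set T := V / (δ * E) with hTdef
  have hT0 : 0 < T := by linarith
  have hlog : 1 / 2 ≤ Real.log T := by
    have h1 := Real.log_two_gt_d9
    have h2 := Real.log_le_log two_pos hT
    linarith
  set w := 1 / θ with hw
  have hw0 : 0 < w := by positivity
  have h1 : (1 + 2 * (w + 1)) * Real.log T ≤ θ * E / k * M := by
    calc _ = θ * E / k * ((1 + 2 * (w + 1)) / θ * E⁻¹ * k * Real.log T) := by field_simp
      _ ≤ _ := by gcongr
  have h2 : Real.exp (-(θ * E / k * M)) ≤ T⁻¹ * Real.exp (-(w + 1)) := by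
    have : T⁻¹ = Real.exp (-Real.log T) := by rw [Real.exp_neg, Real.exp_log hT0]
    rw [this, ← Real.exp_add]
    refine Real.exp_le_exp.2 ?_
    nlinarith
  have h3 : k / (θ * E) ≤ δ * w * T := by
    calc k / (θ * E) ≤ V / (θ * E) := by gcongr
      _ = δ * w * T := by rw [hTdef, hw]; field_simp
  have h4 : w * Real.exp (-(w + 1)) < 1 := by
    rw [Real.exp_neg, ← div_eq_mul_inv, div_lt_one (Real.exp_pos _)]
    linarith [Real.add_one_le_exp (w + 1)]
  calc _ ≤ δ * w * T * (T⁻¹ * Real.exp (-(w + 1))) := by gcongr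
    _ = δ * (w * Real.exp (-(w + 1))) := by field_simp
    _ < δ * 1 := by gcongr
    _ = δ := mul_one δ

/-! ### Choice of constants and conclusion -/

namespace DataSpace

variable {X : Type*} [MetricSpace X] [ConnectedSpace X] [ProperSpace X]
  [MeasurableSpace X] [BorelSpace X]

theorem exists_dist_le_mesh (Ξ : DataSpace X) {n : ℝ} (hK : IsCompact (Ξ.K (2 * n))) {M : ℕ}
    (hM : 0 < M) (z : Fin M → X) {x : X} (hx : x ∈ Ξ.K (2 * n)) :
    ∃ k, dist x (z k) ≤ Ξ.mesh n z := by
  have : Nonempty (Fin M) := ⟨⟨0, hM⟩⟩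
  obtain ⟨k, hk⟩ := Finite.exists_min fun k => dist x (z k)
  refine ⟨k, le_trans ?_ (Ξ.infDist_le_mesh hK z hx)⟩
  refine (Metric.le_infDist (range_nonempty z)).2 ?_
  rintro _ ⟨j, rfl⟩
  exact hk j

theorem mesh_le_diam (Ξ : DataSpace X) [CompactSpace X] (n : ℝ) {M : ℕ} (hM : 0 < M)
    (z : Fin M → X) : Ξ.mesh n z ≤ Metric.diam (univ : Set X) := by
  refine Real.iSup_le (fun x => ?_) Metric.diam_nonneg
  exact (Metric.infDist_le_dist_of_mem (mem_range_self ⟨0, hM⟩)).trans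
    (Metric.dist_le_diam_of_mem isCompact_univ.isBounded (mem_univ _) (mem_univ _))

theorem measureReal_K_le_nbhdMeasure (Ξ : DataSpace X) {n : ℝ} (hK : IsCompact (Ξ.K (2 * n)))
    (e : ℝ) : Ξ.μ.real (Ξ.K (2 * n)) ≤ Ξ.nbhdMeasure n e :=
  measureReal_mono (Metric.self_subset_cthickening _)
    (Ξ.measure_lt_top_of_isBounded hK.isBounded.cthickening).ne

theorem Large.K_one_subset {Ξ : DataSpace X} {N n : ℝ} (h : Ξ.Large N n) (hN : 1 ≤ N) :
    Ξ.K 1 ⊆ Ξ.K (2 * n) := by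
  rcases h with h | ⟨_, h2⟩
  · exact Ξ.K_one_subset (by linarith)
  · rw [h2]; exact subset_univ _

/-- Existence of Marcinkiewicz–Zygmund weights for a fixed relative error, for deterministic points
with small mesh norm and for random points. -/
theorem exists_isMZ_constants (Ξ : DataSpace X) {ε : ℝ} (hε : 0 < ε) :
    ∃ a A N : ℝ, 0 < a ∧ 0 < A ∧ 1 ≤ N ∧ ∀ B : ℝ → ℝ, Ξ.BernsteinLipschitz B → ∀ n : ℝ, 0 < n →
      ∀ e : ℝ, e = min (1 / n) (1 / B (2 * n)) → Ξ.Large N n →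
      (∀ (M : ℕ) (z : Fin M → X), 0 < M → Ξ.mesh n z ≤ a * e →
        ∃ W : Fin M → ℝ, Ξ.IsMZ n (max Ξ.κ 1) ε z W) ∧
      ∀ δ : ℝ, 0 < δ → (N ≤ n ∨ 2 ≤ Ξ.nbhdMeasure n e / (δ * e ^ Ξ.q)) → ∀ M : ℕ,
        A * e ^ (-Ξ.q) * Ξ.μ.real (Ξ.K (2 * n)) *
          Real.log (Ξ.nbhdMeasure n e / (δ * e ^ Ξ.q)) ≤ M →
        Ξ.sampleLaw n M {z | ¬ ∃ W, Ξ.IsMZ n (max Ξ.κ 1) ε z W} < ENNReal.ofReal δ := by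
  have hq1 := Ξ.one_le_q
  have hq : 0 < Ξ.q := lt_of_lt_of_le one_pos hq1
  obtain ⟨a₁, ha₁, N₁, hN₁, hosc⟩ := Ξ.exists_oscillation_le (show 0 < ε / 6 by positivity)
  obtain ⟨N₂, hN₂, htail⟩ := Ξ.exists_lintegral_compl_K_le (show 0 < ε / 3 by positivity)
  obtain ⟨L, hL1, η, hη, N₃, hN₃, hthin⟩ :=
    Ξ.exists_lintegral_thin_le (show 0 < ε / 6 by positivity)
  have hL1' : (1 : ℝ) ≤ L := by exact_mod_cast hL1
  have hv : 0 < Ξ.μ.real (Ξ.K 1) := ENNReal.toReal_pos Ξ.K_one_pos.ne'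
    (Ξ.measure_lt_top_of_isBounded (Ξ.K_compact 1 le_rfl).isBounded).ne
  set v := Ξ.μ.real (Ξ.K 1) with hvdef
  -- Meaningful only for compact `X`, the only case where its value is used; on an unbounded space
  -- `Metric.diam` takes the value `0`.
  set Dm := Metric.diam (univ : Set X) with hDm
  have hDm0 : 0 ≤ Dm := Metric.diam_nonneg
  set a := min a₁ 1 with ha
  have ha0 : 0 < a := by positivity
  have haa₁ : a ≤ a₁ := min_le_left _ _
  have ha1 : a ≤ 1 := min_le_right _ _
  have hN₃0 : 0 < N₃ := by linarith
  -- The second factor secures `m ≥ N₃` for compact `X` and small `n`, where `a * e < Dm` is the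
  -- only information on `e`.
  set b := a * min 1 (1 / (N₃ * (Dm + 1))) with hb
  have hb0 : 0 < b := by positivity
  have hba : b ≤ a := mul_le_of_le_one_right ha0.le (min_le_left _ _)
  set θ := η * (b / (3 * L)) ^ Ξ.q with hθ
  have hθ0 : 0 < θ := by positivity
  -- The entry `2 / v` ensures that the argument of the logarithm is at least `2` when `n ≥ N` and
  -- `δ ≤ 1`, since then `e ^ q ≤ 1 / n`.
  set N := max (max N₁ N₂) (max N₃ (2 / v)) with hN
  have hNN₁ : N₁ ≤ N := (le_max_left _ _).trans (le_max_left _ _)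
  have hNN₂ : N₂ ≤ N := (le_max_right _ _).trans (le_max_left _ _)
  have hNN₃ : N₃ ≤ N := (le_max_left _ _).trans (le_max_right _ _)
  have hNv : 2 / v ≤ N := (le_max_right _ _).trans (le_max_right _ _)
  have hN1 : 1 ≤ N := hN₁.trans hNN₁
  refine ⟨a, (1 + 2 * (1 / θ + 1)) / θ, N, ha0, by positivity, hN1, ?_⟩
  intro B hB n hn e he hl
  have hB0 : 0 < B (2 * n) := (hB _ (by linarith)).1
  have he0 : 0 < e := by rw [he]; positivity
  have hen : e ≤ 1 / n := by rw [he]; exact min_le_left _ _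
  have hK := hl.isCompact hN1
  have hmz : ∀ (M : ℕ) (z : Fin M → X) (s : ℝ), s ≤ a * e →
      (∀ P ∈ Ξ.poly n, ∫⁻ x in {x ∈ Ξ.K (2 * n) | ∀ k, s < dist x (z k)}, ‖P x‖ₑ ∂Ξ.μ ≤
        ENNReal.ofReal (ε / 3) * ∫⁻ x, ‖P x‖ₑ ∂Ξ.μ) →
      ∃ W : Fin M → ℝ, Ξ.IsMZ n (max Ξ.κ 1) ε z W := fun M z s hs hcov => by
    have hs' : s ≤ a₁ * min (1 / n) (1 / B (2 * n)) := by rw [← he]; exact hs.trans (by gcongr)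
    have := Ξ.isMZ_cell (by positivity) (by positivity) (by positivity) hK z
      (hosc B hB n hn (hl.mono hNN₁) s hs') (htail n hn (hl.mono hNN₂)) hcov
    exact ⟨_, this.mono (by linarith)⟩
  have hdet : ∀ (M : ℕ) (z : Fin M → X), 0 < M → Ξ.mesh n z ≤ a * e →
      ∃ W : Fin M → ℝ, Ξ.IsMZ n (max Ξ.κ 1) ε z W := fun M z hM hz => by
    refine hmz M z (a * e) le_rfl fun P _ => ?_
    have hempty : {x ∈ Ξ.K (2 * n) | ∀ k, a * e < dist x (z k)} = ∅ := by
      refine eq_empty_of_forall_notMem ?_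
      rintro x ⟨hxK, hx⟩
      obtain ⟨k, hk⟩ := Ξ.exists_dist_le_mesh hK hM z hxK
      linarith [hx k]
    rw [hempty]
    simp
  refine ⟨hdet, fun δ hδ hor M hM => ?_⟩
  have hKfin : Ξ.μ (Ξ.K (2 * n)) ≠ ⊤ := (Ξ.measure_lt_top_of_isBounded hK.isBounded).ne
  have hK1 := hl.K_one_subset hN1
  have hvK : v ≤ Ξ.μ.real (Ξ.K (2 * n)) := measureReal_mono hK1 hKfin
  have hKpos : Ξ.μ (Ξ.K (2 * n)) ≠ 0 := (Ξ.K_one_pos.trans_le (measure_mono hK1)).ne'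
  have hKV := Ξ.measureReal_K_le_nbhdMeasure hK e
  have hprob : IsProbabilityMeasure (ProbabilityTheory.cond Ξ.μ (Ξ.K (2 * n))) :=
    ProbabilityTheory.cond_isProbabilityMeasure_of_finite hKpos hKfin
  have hE0 : 0 < e ^ Ξ.q := by positivity
  rcases lt_or_ge 1 δ with hδ1 | hδ1
  · calc _ ≤ Ξ.sampleLaw n M univ := measure_mono (subset_univ _)
      _ = 1 := by rw [sampleLaw]; exact measure_univ
      _ < ENNReal.ofReal δ := by rwa [ENNReal.one_lt_ofReal]
  have hT : 2 ≤ Ξ.nbhdMeasure n e / (δ * e ^ Ξ.q) := by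
    rcases hor with hNn | h
    · have hn1 : 1 ≤ n := hN1.trans hNn
      have he1 : e ≤ 1 := hen.trans (by rw [div_le_one hn]; exact hn1)
      have h1 : e ^ Ξ.q ≤ 1 / n := by
        refine le_trans ?_ hen
        simpa using Real.rpow_le_rpow_of_exponent_ge he0 he1 hq1
      have h2 : 2 ≤ v * n := by
        have := hNv.trans hNn
        rw [div_le_iff₀ hv] at this
        linarith
      rw [le_div_iff₀ (by positivity)]
      calc 2 * (δ * e ^ Ξ.q) ≤ v * n * (1 * (1 / n)) := by gcongr
        _ = v := by field_simp
        _ ≤ _ := hvK.trans hKV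
    · exact h
  have hlog : 0 < Real.log (Ξ.nbhdMeasure n e / (δ * e ^ Ξ.q)) := Real.log_pos (by linarith)
  have hM0 : 0 < M := by
    have : (0 : ℝ) < M :=
      lt_of_lt_of_le (mul_pos (mul_pos (by positivity) (hv.trans_le hvK)) hlog) hM
    exact_mod_cast this
  -- If the diameter is at most `a * e`, every sample has small mesh norm and the deterministic case
  -- applies.
  by_cases hbig : CompactSpace X ∧ Dm ≤ a * e
  · have hX := hbig.1
    have : {z : Fin M → X | ¬ ∃ W, Ξ.IsMZ n (max Ξ.κ 1) ε z W} = ∅ :=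
      eq_empty_of_forall_notMem fun z hz =>
        hz (hdet M z hM0 ((Ξ.mesh_le_diam n hM0 z).trans hbig.2))
    rw [this, measure_empty]
    -- The bad event is empty here, so positivity of `δ` suffices.
    exact ENNReal.ofReal_pos.2 hδ
  -- Chosen so that covering at radius `3 (L / m) = b * e` stays within the oscillation scale, while
  -- the thinness threshold `η * m ^ (-q)` is exactly `θ * e ^ q`.
  set m := 3 * L / (b * e) with hm
  have hm0 : 0 < m := by positivity
  have hben : b * e ≤ 1 / n := by
    calc b * e ≤ 1 * (1 / n) := by gcongr; exact hba.trans ha1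
      _ = 1 / n := one_mul _
  have hm3 : 3 * n ≤ m := by
    rw [hm, le_div_iff₀ (by positivity)]
    calc 3 * n * (b * e) ≤ 3 * n * (1 / n) := by gcongr
      _ = 3 * 1 := by field_simp
      _ ≤ 3 * L := by gcongr
  have hmN : N₃ ≤ m := by
    by_cases hNn : N ≤ n
    · linarith [hNN₃.trans hNn]
    · have hX : CompactSpace X := (hl.resolve_left hNn).1
      have hlt : a * e < Dm := by
        by_contra h
        exact hbig ⟨hX, not_lt.1 h⟩
      rw [hm, le_div_iff₀ (by positivity)]
      calc N₃ * (b * e) = N₃ * (min 1 (1 / (N₃ * (Dm + 1))) * (a * e)) := by rw [hb]; ring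
        _ ≤ N₃ * (1 / (N₃ * (Dm + 1)) * (Dm + 1)) := by
            gcongr
            · exact min_le_right _ _
            · linarith
        _ = 1 := by field_simp
        _ ≤ 3 * L := by linarith
  have hR : 3 * (L / m) = b * e := by rw [hm]; field_simp
  have hR0 : 0 ≤ L / m := by positivity
  have hRa : 3 * (L / m) ≤ a * e := by rw [hR]; gcongr
  have hθm : η * m ^ (-Ξ.q) = θ * e ^ Ξ.q := by
    have : m⁻¹ = b / (3 * L) * e := by rw [hm]; field_simp
    rw [Real.rpow_neg hm0.le, ← Real.inv_rpow hm0.le, this, Real.mul_rpow (by positivity) he0.le,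
      hθ]
    ring
  -- If the sample covers all points with thick balls, the uncovered part of `K_{2n}` is thin and
  -- carries at most `ε / 6 + ε / 6` of the mass. With oscillation `ε / 6` and tail `ε / 3` the
  -- total is below `ε`.
  have hsub : {z : Fin M → X | ¬ ∃ W, Ξ.IsMZ n (max Ξ.κ 1) ε z W} ⊆
      {z | ∃ x, θ * e ^ Ξ.q < Ξ.μ.real (Metric.closedBall x (L / m) ∩ Ξ.K (2 * n)) ∧
        ∀ k, 3 * (L / m) < dist x (z k)} := by
    intro z hz
    by_contra hcon
    refine hz (hmz M z (3 * (L / m)) hRa fun P hP => ?_)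
    have hs' : 3 * (L / m) ≤ a₁ * min (1 / n) (1 / B (2 * n)) := by
      rw [← he]; exact hRa.trans (by gcongr)
    obtain ⟨O, hOm, hO, hOi⟩ := hosc B hB n hn (hl.mono hNN₁) _ hs' P hP
    have hth := hthin n m hn (by linarith) hmN (hl.mono hNN₃) P hP O hOm
      fun x x' hxx => hO x x' (by linarith)
    calc _ ≤ ∫⁻ x in {x ∈ Ξ.K (2 * n) | Ξ.μ (Metric.closedBall x (L / m) ∩ Ξ.K (2 * n)) ≤
            ENNReal.ofReal (η * m ^ (-Ξ.q))}, ‖P x‖ₑ ∂Ξ.μ := by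
          refine lintegral_mono_set fun x hx => ⟨hx.1, ?_⟩
          have hle : Ξ.μ.real (Metric.closedBall x (L / m) ∩ Ξ.K (2 * n)) ≤ θ * e ^ Ξ.q := by
            by_contra h
            exact hcon ⟨x, not_le.1 h, hx.2⟩
          rw [hθm]
          exact (ENNReal.le_ofReal_iff_toReal_le
            ((measure_mono inter_subset_right).trans_lt hKfin.lt_top).ne (by positivity)).2 hle
      _ ≤ ENNReal.ofReal (ε / 6) * ∫⁻ x, ‖P x‖ₑ ∂Ξ.μ +
            ENNReal.ofReal (ε / 6) * ∫⁻ x, ‖P x‖ₑ ∂Ξ.μ := hth.trans (by gcongr)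
      _ = _ := by
          rw [← add_mul, ← ENNReal.ofReal_add (by positivity) (by positivity)]
          ring_nf
  refine ((measure_mono hsub).trans (measure_pi_cond_uncovered_le Ξ.μ hK.measurableSet hKfin hKpos
    (L / m) (by positivity) M)).trans_lt ?_
  refine (ENNReal.ofReal_lt_ofReal_iff hδ).2 ?_
  rw [Real.rpow_neg he0.le] at hM
  exact net_mul_exp_lt (hv.trans_le hvK) hKV hE0 hθ0 hδ hT hM

end DataSpace

theorem theorem7p1 {X : Type*} [MetricSpace X] [ConnectedSpace X] [ProperSpace X]
    [MeasurableSpace X] [BorelSpace X] (Ξ : DataSpace X) :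
    ∃ c₁ > 0, ∃ c₂ > 0, ∃ a A N : ℝ → ℝ,
      (∀ ε : ℝ, 0 < ε → 0 < a ε ∧ 0 < A ε ∧ 0 < N ε) ∧
      ∀ B : ℝ → ℝ, Ξ.BernsteinLipschitz B → ∀ n : ℝ, 0 < n →
        -- (a)
        (∀ ε : ℝ, 0 < ε → (N ε ≤ n ∨ (CompactSpace X ∧ Ξ.K (2 * n) = Set.univ)) →
          ∀ (M : ℕ) (z : Fin M → X), 0 < M → (∀ k, z k ∈ Ξ.K (2 * n)) →
            Ξ.mesh n z ≤ a ε * min (1 / n) (1 / B (2 * n)) →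
            ∃ W : Fin M → ℝ, Ξ.IsMZ n c₁ ε z W) ∧
        -- (b)
        ((N (1 / 2) ≤ n ∨ (CompactSpace X ∧ Ξ.K (2 * n) = Set.univ)) →
          ∀ (M : ℕ) (z : Fin M → X), 0 < M → (∀ k, z k ∈ Ξ.K (2 * n)) →
            Ξ.mesh n z ≤ a (1 / 2) * min (1 / n) (1 / B (2 * n)) →
            ∀ W : Fin M → ℝ, Ξ.IsMZ n c₁ (1 / 2) z W →
              ∃ w : Fin M → ℝ, Ξ.IsQuadrature n c₂ z W w) ∧
        -- (c)
        (∀ ε : ℝ, 0 < ε → ∀ δ : ℝ, 0 < δ → ∀ e : ℝ, e = min (1 / n) (1 / B (2 * n)) →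
          (N ε ≤ n ∨ (CompactSpace X ∧ Ξ.K (2 * n) = Set.univ ∧
            2 ≤ Ξ.nbhdMeasure n e / (δ * e ^ Ξ.q))) →
          ∀ M : ℕ,
            A ε * e ^ (-Ξ.q) * Ξ.μ.real (Ξ.K (2 * n)) *
              Real.log (Ξ.nbhdMeasure n e / (δ * e ^ Ξ.q)) ≤ M →
            Ξ.sampleLaw n M {z | ¬ ((∃ W, Ξ.IsMZ n c₁ ε z W) ∧
              ∃ W w, Ξ.IsMZ n c₁ (1 / 2) z W ∧ Ξ.IsQuadrature n c₂ z W w)} <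
                ENNReal.ofReal δ) := by
  choose! a A N ha hA hN h using fun (ε : ℝ) (hε : 0 < ε) => Ξ.exists_isMZ_constants hε
  have hmin : ∀ ε : ℝ, 0 < ε → 0 < min ε (1 / 2) := fun ε hε => lt_min hε (by norm_num)
  -- In (c) the constants for `min ε (1 / 2)` are used, so that a single event yields both
  -- conclusions and no probability is lost.
  refine ⟨max Ξ.κ 1, by positivity, 2 * max Ξ.κ 1, by positivity, a, fun ε => A (min ε (1 / 2)),
    fun ε => max (N ε) (N (min ε (1 / 2))), fun ε hε => ⟨ha ε hε, hA _ (hmin ε hε), ?_⟩, ?_⟩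
  · exact lt_of_lt_of_le (by linarith [hN ε hε]) (le_max_left _ _)
  intro B hB n hn
  refine ⟨fun ε hε hl M z hM _ hz => ?_, fun _ M z _ _ _ W hW => hW.exists_isQuadrature,
    fun ε hε δ hδ e he hl M hM => ?_⟩
  · have hl' : Ξ.Large (N ε) n := hl.imp (le_max_left _ _).trans id
    exact (h ε hε B hB n hn _ rfl hl').1 M z hM hz
  · have hl' : Ξ.Large (N (min ε (1 / 2))) n :=
      hl.imp (le_max_right _ _).trans fun h => ⟨h.1, h.2.1⟩
    have hc := (h _ (hmin ε hε) B hB n hn e he hl').2 δ hδ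
      (hl.imp (le_max_right _ _).trans fun h => h.2.2) M hM
    refine (measure_mono fun z hz => ?_).trans_lt hc
    rintro ⟨W, hW⟩
    refine hz ⟨⟨W, hW.mono (min_le_left _ _)⟩, ?_⟩
    have hW' := hW.mono (min_le_right ε (1 / 2))
    obtain ⟨w, hw⟩ := hW'.exists_isQuadrature
    exact ⟨W, w, hW', hw⟩
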